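/- Let $D$ be a self-adjoint operator in a Hilbert space $H$ for which there is an orthonormal basis $(e_n)_{n\ge 0}$ of $H$ with $De_n=n\,e_n$ for $n=0,1,2,\dots$. Let $R$ be a bounded self-adjoint operator on $H$ whose matrix entries $R_{k,n}=(Re_n,e_k)$ satisfy $\lim_{n\to\infty}R_{n,n+p}=0$ for every fixed $p\in\mathbb Z$ (where for $p<0$ only $n\ge -p$ are considered). Then the operator $T=D+R$, with the domain of $D$, has discrete spectrum (the spectrum consists of isolated eigenvalues of finite multiplicity). Its eigenvalues are real and can be listed in nondecreasing order, each repeated according to its multiplicity, as $\lambda_0(T)\le\lambda_1(T)\le\lambda_2(T)\le\cdots$. The eigenvalue $\lambda_n(T)$ is simple for all sufficiently large $n$, and $$\lambda_n(T)=n+R_{n,n}+O(s_n),\qquad n\to\infty,\qquad\text{where}\quad s_n=\Bigl(\sum_{k\ne n}\frac{|R_{k,n}|^2}{(n-k)^2}\Bigr)^{1/2}.$$ Moreover $s_n\to 0$ as $n\to\infty$. -/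

import Mathlib

open Filter Topology Asymptotics

noncomputable section

namespace PerturbedOscillator

variable {𝕜 : Type*} [RCLike 𝕜] {H : Type*} [NormedAddCommGroup H] [InnerProductSpace 𝕜 H]

/-- The operator `D + R`, where `D` is an unbounded operator and `R` an everywhere defined bounded
one; its domain is the domain of `D`. -/
def perturb (D : H →ₗ.[𝕜] H) (R : H →L[𝕜] H) : H →ₗ.[𝕜] H :=
  (R : H →ₗ[𝕜] H) +ᵥ D

/-- The map `T - μ` from the domain of `T` to `H`. -/
def shift (T : H →ₗ.[𝕜] H) (μ : 𝕜) : T.domain →ₗ[𝕜] H :=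
  T.toFun - μ • T.domain.subtype

/-- The eigenspace of `T` at `μ`: all `x` in the domain of `T` with `T x = μ x`
(it is zero when `μ` is not an eigenvalue). -/
def eigenspace (T : H →ₗ.[𝕜] H) (μ : 𝕜) : Submodule 𝕜 T.domain :=
  LinearMap.ker (shift T μ)

/-- The spectrum of an unbounded operator: all `μ` for which `T - μ` does not have an everywhere
defined bounded two-sided inverse `S : H → dom T`. -/
def spectrum (T : H →ₗ.[𝕜] H) : Set 𝕜 :=
  {μ | ¬ ∃ S : H →L[𝕜] H,
    (∀ y : H, ∃ hy : S y ∈ T.domain, shift T μ ⟨S y, hy⟩ = y) ∧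
    (∀ x : T.domain, S (shift T μ x) = x)}

/-- Discreteness of the spectrum of a self-adjoint operator: every point of the spectrum is
isolated in the spectrum and is an eigenvalue of finite multiplicity. -/
def HasDiscreteSpectrum (T : H →ₗ.[𝕜] H) : Prop :=
  ∀ μ ∈ spectrum T,
    (∃ ε : ℝ, 0 < ε ∧ ∀ ν ∈ spectrum T, ν ≠ μ → ε ≤ dist ν μ) ∧
    eigenspace T μ ≠ ⊥ ∧ FiniteDimensional 𝕜 (eigenspace T μ)

/-- `lam 0 ≤ lam 1 ≤ lam 2 ≤ …` is the list of all the eigenvalues of `T`, each one repeated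
according to its (finite) multiplicity. -/
def IsEigenvalueEnumeration (T : H →ₗ.[𝕜] H) (lam : ℕ → ℝ) : Prop :=
  Monotone lam ∧
  ∀ μ : 𝕜, FiniteDimensional 𝕜 (eigenspace T μ) ∧
    {n : ℕ | (lam n : 𝕜) = μ}.encard = (Module.finrank 𝕜 (eigenspace T μ) : ℕ∞)

/-- The matrix entry `R_{k,n} = (R e_n, e_k)` of `R` in the orthonormal basis `e`
(Mathlib's inner product is linear in the second argument). -/
def entry (e : HilbertBasis ℕ 𝕜 H) (R : H →L[𝕜] H) (k n : ℕ) : 𝕜 :=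
  inner 𝕜 (e k) (R (e n))

/-- The remainder `s_n = (∑_{k ≠ n} |R_{k,n}|² / (n - k)²)^{1/2}`. -/
def remainder (e : HilbertBasis ℕ 𝕜 H) (R : H →L[𝕜] H) (n : ℕ) : ℝ :=
  Real.sqrt (∑' k : {k : ℕ // k ≠ n}, ‖entry e R k n‖ ^ 2 / ((n : ℝ) - (k : ℕ)) ^ 2)

/-- The series in the definition of the remainder always converges. -/
theorem summable_remainder (e : HilbertBasis ℕ 𝕜 H) (R : H →L[𝕜] H) (n : ℕ) :
    Summable fun k : {k : ℕ // k ≠ n} =>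
      ‖entry e R k n‖ ^ 2 / ((n : ℝ) - (k : ℕ)) ^ 2 := by
  have h : Summable fun k : ℕ => ‖entry e R k n‖ ^ 2 :=
    e.orthonormal.inner_products_summable (R (e n))
  refine Summable.of_nonneg_of_le (fun k => by positivity) (fun k => ?_)
    (h.comp_injective (Subtype.val_injective (p := fun k : ℕ => k ≠ n)))
  obtain ⟨k, hk⟩ := k
  refine div_le_self (by positivity) ?_
  have h1 : (1 : ℤ) ≤ ((n : ℤ) - k) ^ 2 := by
    have : ((n : ℤ) - k) ≠ 0 := by omega
    have := sq_pos_of_ne_zero this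
    omega
  exact_mod_cast h1

end PerturbedOscillator

end

/-! For large `n` the quadratic form of `R` is small relative to that of `1 + |D - n|`
(`eventually_norm_inner_le`): the modes within distance `M` of `n` meet only finitely many diagonals
of the matrix, whose entries tend to zero, while the far modes gain a factor `(M + 1)^(-1/2)` from
the weight. Hence the form of `T - (n + 1/2)` is negative on the span of `e 0, …, e n` and positive
on domain vectors orthogonal to it. A dimension count (`SmallForm.card_le`, `SmallForm.le_card`)
then puts exactly `n + 1` eigenvalues below `n + 1/2`, so eventually `|λ_n - n| < 1/2` and `λ_n` is
simple. Discreteness and a Hilbert basis of eigenvectors come from a compact resolvent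
(`exists_isCompactResolvent`).

For the asymptotics, a unit eigenvector `x` with eigenvalue `l` near `n` satisfies `(l - k) x_k = (R
x)_k` for all `k`. The equation for `k = n` reads `(l - n - R_{n,n}) x_n = ∑_{k ≠ n} R_{n,k} x_k`.
Cauchy–Schwarz with weights `|n - k|` bounds the right side by `s_n · 2‖R‖`, since `|n - k| ≤ 2 |l -
k|`. Testing the eigenvalue equation against `sign(D - n) x` gives `|x_n|² ≥ 1/2`, so `x_n` can be
divided out (`SmallForm.norm_eigenvalue_sub_le`). The same smallness of the form of `R` yields `s_n
→ 0` (`tendsto_remainder`). -/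

namespace PerturbedOscillator

/-! ### Coordinate description of `D` and of `D + R`. -/

section

variable {𝕜 : Type*} [RCLike 𝕜] {H : Type*} [NormedAddCommGroup H] [InnerProductSpace 𝕜 H]

theorem mem_eigenspace_iff {T : H →ₗ.[𝕜] H} {μ : 𝕜} {x : T.domain} :
    x ∈ eigenspace T μ ↔ T x = μ • (x : H) := by
  rw [eigenspace, LinearMap.mem_ker, shift]
  exact sub_eq_zero

theorem shift_apply (T : H →ₗ.[𝕜] H) (μ : 𝕜) (x : T.domain) :
    shift T μ x = T x - μ • (x : H) := rfl

/-- Two vectors with the same coordinates in a Hilbert basis are equal. -/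
theorem ext_inner_basis {ι : Type*} (e : HilbertBasis ι 𝕜 H) {x y : H}
    (h : ∀ k, inner 𝕜 (e k) x = inner 𝕜 (e k) y) : x = y := by
  apply e.repr.injective
  ext k
  simp only [e.repr_apply_apply, h k]

/-- Parseval's identity. -/
theorem hasSum_sq_norm_inner {ι : Type*} (e : HilbertBasis ι 𝕜 H) (x : H) :
    HasSum (fun k => ‖inner 𝕜 (e k) x‖ ^ 2) (‖x‖ ^ 2) := by
  have h := RCLike.hasSum_re 𝕜 (e.hasSum_inner_mul_inner x x)
  rw [inner_self_eq_norm_sq] at h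
  refine h.congr_fun fun k => ?_
  rw [← inner_conj_symm x (e k), RCLike.conj_mul]
  norm_cast

/-- The operator `D` acts as `x_k ↦ k x_k` in the coordinates of the Hilbert basis `e`, on its
maximal domain. -/
def IsNumberOperator (e : HilbertBasis ℕ 𝕜 H) (D : H →ₗ.[𝕜] H) : Prop :=
  ∀ x w : H, (∃ hx : x ∈ D.domain, D ⟨x, hx⟩ = w) ↔
    ∀ k : ℕ, inner 𝕜 (e k) w = (k : 𝕜) * inner 𝕜 (e k) x

/-- Self-adjointness forces the domain to be maximal: if the sequence `k x_k` is the coordinate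
sequence of some `w`, then `⟨w, v⟩ = ⟨x, D v⟩` on the domain, so `x` lies in the domain of the
adjoint, which is `D`. -/
theorem isNumberOperator_of_isSelfAdjoint [CompleteSpace H] {D : H →ₗ.[𝕜] H}
    (hD : IsSelfAdjoint D) {e : HilbertBasis ℕ 𝕜 H}
    (he : ∀ n : ℕ, ∃ hn : e n ∈ D.domain, D ⟨e n, hn⟩ = (n : 𝕜) • e n) :
    IsNumberOperator e D := by
  have hdense := hD.dense_domain
  have hadj : D.adjoint = D := LinearPMap.isSelfAdjoint_def.1 hD
  have hform : D.IsFormalAdjoint D := by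
    have := LinearPMap.adjoint_isFormalAdjoint hdense
    rwa [hadj] at this
  have hcoord : ∀ (x : D.domain) (k : ℕ), inner 𝕜 (e k) (D x) = (k : 𝕜) * inner 𝕜 (e k) (x : H) := by
    intro x k
    obtain ⟨hk, hDk⟩ := he k
    have h := hform ⟨e k, hk⟩ x
    rw [hDk, inner_smul_left] at h
    simpa using h.symm
  intro x w
  constructor
  · rintro ⟨hx, rfl⟩ k
    exact hcoord ⟨x, hx⟩ k
  · intro hw
    have hx : x ∈ D.domain := by
      rw [← hadj]
      refine LinearPMap.mem_adjoint_domain_of_exists x ⟨w, fun v => ?_⟩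
      rw [← e.tsum_inner_mul_inner, ← e.tsum_inner_mul_inner]
      refine tsum_congr fun k => ?_
      rw [hcoord v k, ← inner_conj_symm w, ← inner_conj_symm x, hw k]
      simp only [map_mul, map_natCast]
      ring
    exact ⟨hx, ext_inner_basis e fun k => by rw [hcoord ⟨x, hx⟩ k, hw k]⟩

variable {D : H →ₗ.[𝕜] H} {R : H →L[𝕜] H} {e : HilbertBasis ℕ 𝕜 H}

theorem exists_perturb_eq_iff (hD : IsNumberOperator e D) (x w : H) :
    (∃ hx : x ∈ (perturb D R).domain, perturb D R ⟨x, hx⟩ = w) ↔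
      ∀ k : ℕ, inner 𝕜 (e k) w = (k : 𝕜) * inner 𝕜 (e k) x + inner 𝕜 (e k) (R x) := by
  have h := hD x (w - R x)
  simp only [inner_sub_right, sub_eq_iff_eq_add, eq_sub_iff_add_eq] at h
  rw [← h]
  refine exists_congr fun hx => ?_
  rw [add_comm]
  exact Iff.rfl

theorem inner_perturb (hD : IsNumberOperator e D) (x : (perturb D R).domain) (k : ℕ) :
    inner 𝕜 (e k) (perturb D R x) =
      (k : 𝕜) * inner 𝕜 (e k) (x : H) + inner 𝕜 (e k) (R x) :=
  (exists_perturb_eq_iff hD (x : H) _).1 ⟨x.2, rfl⟩ k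

theorem basis_mem_domain (hD : IsNumberOperator e D) (n : ℕ) :
    e n ∈ (perturb D R).domain := by
  have h := (hD (e n) ((n : 𝕜) • e n)).2 fun k => by
    rw [inner_smul_right]
    rcases eq_or_ne k n with rfl | h
    · rfl
    · rw [e.orthonormal.2 h, mul_zero, mul_zero]
  exact h.1

theorem perturb_symmetric [CompleteSpace H] (hD : IsNumberOperator e D) (hR : IsSelfAdjoint R)
    (x y : (perturb D R).domain) :
    inner 𝕜 (perturb D R x) (y : H) = inner 𝕜 (x : H) (perturb D R y) := by
  have key : ∀ u v : D.domain, inner 𝕜 (D u) (v : H) = inner 𝕜 (u : H) (D v) := by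
    intro u v
    rw [← e.tsum_inner_mul_inner, ← e.tsum_inner_mul_inner]
    refine tsum_congr fun k => ?_
    rw [(hD v _).1 ⟨v.2, rfl⟩ k, ← inner_conj_symm (D u), (hD u _).1 ⟨u.2, rfl⟩ k,
      ← inner_conj_symm (u : H)]
    simp only [map_mul, map_natCast]
    ring
  change inner 𝕜 (R x + D ⟨x, x.2⟩) (y : H) = inner 𝕜 (x : H) (R y + D ⟨y, y.2⟩)
  rw [inner_add_left, inner_add_right, key ⟨x, x.2⟩ ⟨y, y.2⟩]
  congr 1
  exact hR.isSymmetric (x : H) (y : H)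

end

/-! ### Smallness of the form of `R` relative to `1 + |D - n|`. -/

section

variable {𝕜 : Type*} [RCLike 𝕜] {H : Type*} [NormedAddCommGroup H] [InnerProductSpace 𝕜 H]

/-- The weight `1 + |k - n|` comparing the mode `k` with the mode `n`. -/
def weight (n k : ℕ) : ℝ := 1 + |(k : ℝ) - n|

theorem one_le_weight (n k : ℕ) : 1 ≤ weight n k := by
  have := abs_nonneg ((k : ℝ) - n)
  unfold weight
  linarith

theorem weight_nonneg (n k : ℕ) : 0 ≤ weight n k := zero_le_one.trans (one_le_weight n k)

/-- The vector `x` lies in the form domain of the number operator of `e`. -/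
def FiniteEnergy (e : HilbertBasis ℕ 𝕜 H) (x : H) : Prop :=
  Summable fun k : ℕ => (k : ℝ) * ‖inner 𝕜 (e k) x‖ ^ 2

/-- The quadratic form of `1 + |D - n|`, where `D` is the number operator of `e`. -/
noncomputable def energy (e : HilbertBasis ℕ 𝕜 H) (n : ℕ) (x : H) : ℝ :=
  ∑' k : ℕ, weight n k * ‖inner 𝕜 (e k) x‖ ^ 2

variable {e : HilbertBasis ℕ 𝕜 H} {D : H →ₗ.[𝕜] H} {R : H →L[𝕜] H}

theorem FiniteEnergy.summable {x : H} (hx : FiniteEnergy e x) (n : ℕ) :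
    Summable fun k : ℕ => weight n k * ‖inner 𝕜 (e k) x‖ ^ 2 := by
  refine Summable.of_nonneg_of_le (fun k => mul_nonneg (weight_nonneg n k) (sq_nonneg _))
    (fun k => ?_) (((hasSum_sq_norm_inner e x).summable.mul_left (1 + n : ℝ)).add hx)
  rw [← add_mul]
  refine mul_le_mul_of_nonneg_right ?_ (sq_nonneg _)
  have : |(k : ℝ) - n| ≤ k + n := by
    rw [abs_le]
    constructor <;> linarith [k.cast_nonneg (α := ℝ), n.cast_nonneg (α := ℝ)]
  unfold weight
  linarith

theorem energy_nonneg (e : HilbertBasis ℕ 𝕜 H) (n : ℕ) (x : H) : 0 ≤ energy e n x :=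
  tsum_nonneg fun k => mul_nonneg (weight_nonneg n k) (sq_nonneg _)

theorem FiniteEnergy.sq_norm_le_energy {x : H} (hx : FiniteEnergy e x) (n : ℕ) :
    ‖x‖ ^ 2 ≤ energy e n x := by
  rw [← (hasSum_sq_norm_inner e x).tsum_eq]
  refine (hasSum_sq_norm_inner e x).summable.tsum_le_tsum (fun k => ?_) (hx.summable n)
  exact le_mul_of_one_le_left (sq_nonneg _) (one_le_weight n k)

theorem FiniteEnergy.norm_le_sqrt_energy {x : H} (hx : FiniteEnergy e x) (n : ℕ) :
    ‖x‖ ≤ √(energy e n x) :=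
  Real.le_sqrt_of_sq_le (hx.sq_norm_le_energy n)

theorem FiniteEnergy.of_domain (hD : IsNumberOperator e D) (x : (perturb D R).domain) :
    FiniteEnergy e (x : H) := by
  have hx : (x : H) ∈ D.domain := x.2
  refine Summable.of_nonneg_of_le (fun k => by positivity) (fun k => ?_)
    (hasSum_sq_norm_inner e (D ⟨x, hx⟩)).summable
  rw [(hD (x : H) _).1 ⟨hx, rfl⟩ k, norm_mul, RCLike.norm_natCast, mul_pow]
  refine mul_le_mul_of_nonneg_right ?_ (sq_nonneg _)
  exact_mod_cast Nat.le_self_pow two_ne_zero k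

theorem FiniteEnergy.of_norm_le {x y : H} (hx : FiniteEnergy e x)
    (h : ∀ k, ‖inner 𝕜 (e k) y‖ ≤ ‖inner 𝕜 (e k) x‖) : FiniteEnergy e y :=
  Summable.of_nonneg_of_le (fun k => by positivity) (fun k => by gcongr; exact h k) hx

theorem energy_le_of_norm_le {x y : H} (hx : FiniteEnergy e x)
    (h : ∀ k, ‖inner 𝕜 (e k) y‖ ≤ ‖inner 𝕜 (e k) x‖) (n : ℕ) : energy e n y ≤ energy e n x := by
  refine ((hx.of_norm_le h).summable n).tsum_le_tsum (fun k => ?_) (hx.summable n)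
  have := weight_nonneg n k
  gcongr
  exact h k

/-- The orthogonal projection onto the span of the `e k` with `k ∈ S`. -/
noncomputable def truncate (e : HilbertBasis ℕ 𝕜 H) (S : Finset ℕ) (x : H) : H :=
  ∑ k ∈ S, inner 𝕜 (e k) x • e k

theorem inner_sum_smul (e : HilbertBasis ℕ 𝕜 H) (S : Finset ℕ) (c : ℕ → 𝕜) (k : ℕ) :
    inner 𝕜 (e k) (∑ j ∈ S, c j • e j) = if k ∈ S then c k else 0 := by
  classical
  simp only [inner_sum, inner_smul_right, orthonormal_iff_ite.1 e.orthonormal, mul_ite, mul_one,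
    mul_zero, Finset.sum_ite_eq]

theorem inner_truncate (S : Finset ℕ) (x : H) (k : ℕ) :
    inner 𝕜 (e k) (truncate e S x) = if k ∈ S then inner 𝕜 (e k) x else 0 :=
  inner_sum_smul e S _ k

theorem norm_truncate_le (S : Finset ℕ) (x : H) : ‖truncate e S x‖ ≤ ‖x‖ := by
  refine le_of_sq_le_sq ?_ (norm_nonneg _)
  refine hasSum_le (fun k => ?_) (hasSum_sq_norm_inner e (truncate e S x))
    (hasSum_sq_norm_inner e x)
  rw [inner_truncate]
  split_ifs
  · rfl
  · simp

theorem FiniteEnergy.norm_sub_truncate_le {x : H} (hx : FiniteEnergy e x) {n : ℕ} {S : Finset ℕ}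
    {M : ℝ} (hM : 0 < M) (hS : ∀ k ∉ S, M ≤ weight n k) :
    ‖x - truncate e S x‖ ≤ √(energy e n x) / √M := by
  rw [← Real.sqrt_div' _ hM.le]
  refine Real.le_sqrt_of_sq_le ?_
  rw [le_div_iff₀ hM]
  refine hasSum_le (fun k => ?_) ((hasSum_sq_norm_inner e _).mul_right M)
    (hx.summable n).hasSum
  rw [inner_sub_right, inner_truncate]
  split_ifs with h
  · simpa using mul_nonneg (weight_nonneg n k) (sq_nonneg _)
  · rw [sub_zero, mul_comm]
    exact mul_le_mul_of_nonneg_right (hS k h) (sq_nonneg _)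

theorem norm_inner_truncate_le {S : Finset ℕ} {η : ℝ}
    (hS : ∀ k ∈ S, ∀ m ∈ S, ‖entry e R k m‖ ≤ η) (x y : H) :
    ‖inner 𝕜 (truncate e S y) (R (truncate e S x))‖ ≤ (S.card : ℝ) ^ 2 * η * ‖x‖ * ‖y‖ := by
  have hb : ∀ (k : ℕ) (z : H), ‖inner 𝕜 (e k) z‖ ≤ ‖z‖ := fun k z => by
    simpa [e.orthonormal.1 k] using norm_inner_le_norm (𝕜 := 𝕜) (e k) z
  simp only [truncate, map_sum, map_smul, sum_inner, inner_sum, inner_smul_left, inner_smul_right,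
    Finset.mul_sum]
  have hbound : ∀ k ∈ S, ∀ m ∈ S, ‖inner 𝕜 (e m) x *
      ((starRingEnd 𝕜) (inner 𝕜 (e k) y) * inner 𝕜 (e k) (R (e m)))‖ ≤ η * ‖x‖ * ‖y‖ := by
    intro k hk m hm
    rw [norm_mul, norm_mul, RCLike.norm_conj]
    have h1 := hS k hk m hm
    rw [entry] at h1
    calc _ ≤ ‖x‖ * (‖y‖ * η) := by gcongr <;> apply hb
      _ = _ := by ring
  refine (norm_sum_le _ _).trans ((Finset.sum_le_card_nsmul S _ (S.card • (η * ‖x‖ * ‖y‖))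
    fun k hk => (norm_sum_le _ _).trans (Finset.sum_le_card_nsmul S _ _
      fun m hm => hbound m hm k hk)).trans_eq ?_)
  simp only [nsmul_eq_mul]
  ring

/-- Entries with both indices in the window lie on the diagonals `p = m - k` with `|p| ≤ 2M`;
finitely many limits are eventually uniform. -/
theorem eventually_norm_entry_le
    (hlim : ∀ p : ℤ, Tendsto (fun n : ℕ => entry e R n ((n : ℤ) + p).toNat) atTop (𝓝 0))
    (M : ℕ) {η : ℝ} (hη : 0 < η) :
    ∀ᶠ n : ℕ in atTop, ∀ k ∈ Finset.Icc (n - M) (n + M), ∀ m ∈ Finset.Icc (n - M) (n + M),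
      ‖entry e R k m‖ ≤ η := by
  have h : ∀ᶠ n : ℕ in atTop, ∀ p ∈ Finset.Icc (-2 * M : ℤ) (2 * M),
      ‖entry e R n ((n : ℤ) + p).toNat‖ ≤ η := by
    rw [Filter.eventually_all_finset]
    intro p _
    have := (hlim p).norm
    rw [norm_zero] at this
    exact this.eventually_le_const hη
  obtain ⟨N, hN⟩ := eventually_atTop.1 h
  refine eventually_atTop.2 ⟨N + M, fun n hn k hk m hm => ?_⟩
  rw [Finset.mem_Icc] at hk hm
  have := hN k (by omega) ((m : ℤ) - k) (by rw [Finset.mem_Icc]; omega)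
  simpa using this

/-- The form of `R` is small relative to that of `1 + |D - n|`, for large `n`. -/
theorem eventually_norm_inner_le
    (hlim : ∀ p : ℤ, Tendsto (fun n : ℕ => entry e R n ((n : ℤ) + p).toNat) atTop (𝓝 0))
    {ε : ℝ} (hε : 0 < ε) :
    ∀ᶠ n : ℕ in atTop, ∀ x y : H, FiniteEnergy e x → FiniteEnergy e y →
      ‖inner 𝕜 y (R x)‖ ≤ ε * √(energy e n x) * √(energy e n y) := by
  -- The two terms with a far component cost `‖R‖ / √(M + 1)` each; together they must use at most
  -- half of `ε`. The other half goes to the window, where `C` bounds the number of entries.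
  obtain ⟨M, hM⟩ : ∃ M : ℕ, 2 * ‖R‖ / √(M + 1 : ℝ) < ε / 2 := by
    have h : Tendsto (fun M : ℕ => 2 * ‖R‖ / √(M + 1 : ℝ)) atTop (𝓝 0) :=
      (Real.tendsto_sqrt_atTop.comp
        (tendsto_natCast_atTop_atTop.atTop_add tendsto_const_nhds)).const_div_atTop _
    exact (h.eventually_lt_const (half_pos hε)).exists
  set C : ℝ := (2 * M + 1 : ℝ) ^ 2 with hC
  have hC0 : 0 < C := by positivity
  filter_upwards [eventually_norm_entry_le hlim M (η := ε / 2 / C) (by positivity)]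
    with n hn x y hx hy
  set S := Finset.Icc (n - M) (n + M)
  have hcard : ((S.card : ℕ) : ℝ) ≤ 2 * M + 1 := by
    have : S.card ≤ 2 * M + 1 := by simp only [S, Nat.card_Icc]; omega
    exact_mod_cast this
  have hS : ∀ k ∉ S, (M + 1 : ℝ) ≤ weight n k := by
    intro k hk
    have h : (M : ℤ) ≤ |(k : ℤ) - n| := by
      rw [Finset.mem_Icc, not_and_or] at hk
      rw [le_abs]
      omega
    have : (M : ℝ) ≤ |(k : ℝ) - n| := by exact_mod_cast h
    unfold weight
    linarith
  have hM0 : (0 : ℝ) < M + 1 := by positivity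
  set X := √(energy e n x)
  set Y := √(energy e n y)
  set r := √(M + 1 : ℝ)
  have hr : 0 < r := Real.sqrt_pos.2 hM0
  have hxX : ‖x‖ ≤ X := hx.norm_le_sqrt_energy n
  have hyY : ‖y‖ ≤ Y := hy.norm_le_sqrt_energy n
  have hX : 0 ≤ X := Real.sqrt_nonneg _
  have hY : 0 ≤ Y := Real.sqrt_nonneg _
  have hx2 := hx.norm_sub_truncate_le hM0 hS
  have hy2 := hy.norm_sub_truncate_le hM0 hS
  set x₁ := truncate e S x
  set y₁ := truncate e S y
  have hsplit : inner 𝕜 y (R x) =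
      inner 𝕜 y₁ (R x₁) + inner 𝕜 (y - y₁) (R x₁) + inner 𝕜 y (R (x - x₁)) := by
    rw [map_sub, inner_sub_left, inner_sub_right]
    ring
  have h1 : ‖inner 𝕜 y₁ (R x₁)‖ ≤ ε / 2 * X * Y := by
    refine (norm_inner_truncate_le hn x y).trans ?_
    have : (S.card : ℝ) ^ 2 ≤ C := by rw [hC]; gcongr
    calc _ ≤ C * (ε / 2 / C) * X * Y := by gcongr
      _ = _ := by rw [mul_div_cancel₀ _ hC0.ne']
  have h2 : ‖inner 𝕜 (y - y₁) (R x₁)‖ ≤ ‖R‖ / r * X * Y := by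
    calc _ ≤ ‖y - y₁‖ * (‖R‖ * ‖x₁‖) :=
          (norm_inner_le_norm _ _).trans (by gcongr; exact R.le_opNorm _)
      _ ≤ (Y / r) * (‖R‖ * X) := by
          gcongr
          exact (norm_truncate_le S x).trans hxX
      _ = _ := by ring
  have h3 : ‖inner 𝕜 y (R (x - x₁))‖ ≤ ‖R‖ / r * X * Y := by
    calc _ ≤ ‖y‖ * (‖R‖ * ‖x - x₁‖) :=
          (norm_inner_le_norm _ _).trans (by gcongr; exact R.le_opNorm _)
      _ ≤ Y * (‖R‖ * (X / r)) := by gcongr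
      _ = _ := by ring
  rw [hsplit]
  refine (norm_add₃_le).trans ?_
  have h4 : 2 * ‖R‖ / r * (X * Y) ≤ ε / 2 * (X * Y) := by gcongr
  have h5 : 2 * ‖R‖ / r * (X * Y) = 2 * (‖R‖ / r * X * Y) := by ring
  nlinarith

end

/-! ### Counting eigenvalues below `n + 1/2`. -/

section

variable {𝕜 : Type*} [RCLike 𝕜] {H : Type*} [NormedAddCommGroup H] [InnerProductSpace 𝕜 H]
  {e : HilbertBasis ℕ 𝕜 H} {D : H →ₗ.[𝕜] H} {R : H →L[𝕜] H}

/-- Tests `T - l` against `y = σ(D) x`. Counting uses `σ = 1`; the localization of eigenvectors uses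
the sign of `k - n`. -/
theorem hasSum_form (hD : IsNumberOperator e D) (x : (perturb D R).domain) (l : ℝ) {y : H}
    {σ : ℕ → ℝ} (hσ : ∀ k, inner 𝕜 (e k) y = (σ k : 𝕜) * inner 𝕜 (e k) (x : H)) :
    HasSum (fun k : ℕ => σ k * ((k : ℝ) - l) * ‖inner 𝕜 (e k) (x : H)‖ ^ 2)
      (RCLike.re (inner 𝕜 y (perturb D R x - (l : 𝕜) • (x : H))) - RCLike.re (inner 𝕜 y (R x))) := by
  rw [← map_sub, ← inner_sub_right]
  refine (RCLike.hasSum_re 𝕜 (e.hasSum_inner_mul_inner y _)).congr_fun fun k => ?_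
  rw [inner_sub_right, inner_sub_right, inner_perturb hD, inner_smul_right,
    ← inner_conj_symm y, hσ k, map_mul (starRingEnd 𝕜), RCLike.conj_ofReal]
  have : ((σ k : 𝕜) * (starRingEnd 𝕜) (inner 𝕜 (e k) (x : H)) * ((k : 𝕜) * inner 𝕜 (e k) (x : H)
      + inner 𝕜 (e k) (R x) - (l : 𝕜) * inner 𝕜 (e k) (x : H) - inner 𝕜 (e k) (R x))) =
      ((σ k * ((k : ℝ) - l) : ℝ) : 𝕜) *
        ((starRingEnd 𝕜) (inner 𝕜 (e k) (x : H)) * inner 𝕜 (e k) (x : H)) := by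
    push_cast
    ring
  rw [this, RCLike.conj_mul]
  norm_cast

/-- The form of `R` is dominated by an eighth of the form of `1 + |D - n|`. -/
def SmallForm (e : HilbertBasis ℕ 𝕜 H) (R : H →L[𝕜] H) (n : ℕ) : Prop :=
  ∀ x y : H, FiniteEnergy e x → FiniteEnergy e y →
      ‖inner 𝕜 y (R x)‖ ≤ 1 / 8 * √(energy e n x) * √(energy e n y)

theorem SmallForm.abs_re_inner_le {n : ℕ} (h : SmallForm e R n) {x y : H} (hx : FiniteEnergy e x)
    (hy : ∀ k, ‖inner 𝕜 (e k) y‖ ≤ ‖inner 𝕜 (e k) x‖) :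
    |RCLike.re (inner 𝕜 y (R x))| ≤ 1 / 8 * energy e n x := by
  refine (RCLike.abs_re_le_norm _).trans ((h x y hx (hx.of_norm_le hy)).trans ?_)
  calc _ ≤ 1 / 8 * √(energy e n x) * √(energy e n x) := by
        gcongr
        exact energy_le_of_norm_le hx hy n
    _ = _ := by rw [mul_assoc, Real.mul_self_sqrt (energy_nonneg e n x)]

theorem eq_zero_of_energy_le {x : H} (hx : FiniteEnergy e x) {n : ℕ}
    (h : 1 / 4 * energy e n x ≤ 1 / 8 * energy e n x) : x = 0 := by
  have h1 := hx.sq_norm_le_energy n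
  have h2 : ‖x‖ ^ 2 ≤ 0 := by linarith
  exact norm_eq_zero.1 (pow_eq_zero_iff two_ne_zero |>.1 (le_antisymm h2 (sq_nonneg _)))

/-- The constant `1/4` is attained at `k = n + 1`. It exceeds the `1/8` in `SmallForm`, which leaves
`R` unable to change the sign of the form. -/
theorem weight_le_of_lt {n k : ℕ} (h : n < k) : 1 / 4 * weight n k ≤ (k : ℝ) - (n + 1 / 2) := by
  have h' : (n : ℝ) + 1 ≤ k := by exact_mod_cast h
  rw [weight, abs_of_nonneg (by linarith)]
  linarith

theorem weight_le_of_le {n k : ℕ} (h : k ≤ n) : 1 / 4 * weight n k ≤ (n + 1 / 2) - (k : ℝ) := by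
  have h' : (k : ℝ) ≤ n := by exact_mod_cast h
  rw [weight, abs_of_nonpos (by linarith)]
  linarith

theorem re_inner_sub_smul (x w : H) (l : ℝ) :
    RCLike.re (inner 𝕜 x (w - (l : 𝕜) • x)) = RCLike.re (inner 𝕜 x w) - l * ‖x‖ ^ 2 := by
  rw [inner_sub_right, inner_smul_right, map_sub, RCLike.re_ofReal_mul, inner_self_eq_norm_sq]

/-- The form of `T - (n + 1/2)` is positive on the vectors orthogonal to `e 0, …, e n`. -/
theorem SmallForm.eq_zero_of_orthogonal {n : ℕ} (h : SmallForm e R n) (hD : IsNumberOperator e D)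
    (x : (perturb D R).domain) (hx : ∀ k ≤ n, inner 𝕜 (e k) (x : H) = 0)
    (hform : RCLike.re (inner 𝕜 (x : H) (perturb D R x)) ≤ (n + 1 / 2 : ℝ) * ‖(x : H)‖ ^ 2) :
    (x : H) = 0 := by
  have hE := FiniteEnergy.of_domain hD x
  have hs := hasSum_form hD x (n + 1 / 2 : ℝ) (y := x) (σ := fun _ => 1) (fun k => by simp)
  have h1 := hasSum_le (fun k => ?_) ((hE.summable n).hasSum.mul_left (1 / 4)) hs
  · change 1 / 4 * energy e n x ≤ _ at h1
    rw [re_inner_sub_smul] at h1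
    have h2 := abs_le.1 (h.abs_re_inner_le hE (y := x) fun k => le_rfl)
    exact eq_zero_of_energy_le hE (n := n) (by linarith [h2.1])
  · rcases le_or_gt k n with hk | hk
    · simp [hx k hk]
    · rw [← mul_assoc, one_mul]
      exact mul_le_mul_of_nonneg_right (weight_le_of_lt hk) (sq_nonneg _)

/-- The form of `T - (n + 1/2)` is negative on the span of `e 0, …, e n`. -/
theorem SmallForm.eq_zero_of_mem_span {n : ℕ} (h : SmallForm e R n) (hD : IsNumberOperator e D)
    (x : (perturb D R).domain) (hx : ∀ k, n < k → inner 𝕜 (e k) (x : H) = 0)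
    (hform : (n + 1 / 2 : ℝ) * ‖(x : H)‖ ^ 2 ≤ RCLike.re (inner 𝕜 (x : H) (perturb D R x))) :
    (x : H) = 0 := by
  have hE := FiniteEnergy.of_domain hD x
  have hs := hasSum_form hD x (n + 1 / 2 : ℝ) (y := x) (σ := fun _ => 1) (fun k => by simp)
  have h1 := hasSum_le (fun k => ?_) ((hE.summable n).hasSum.mul_left (1 / 4)) hs.neg
  · change 1 / 4 * energy e n x ≤ _ at h1
    rw [re_inner_sub_smul] at h1
    have h2 := abs_le.1 (h.abs_re_inner_le hE (y := x) fun k => le_rfl)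
    exact eq_zero_of_energy_le hE (n := n) (by linarith [h2.2])
  · rcases le_or_gt k n with hk | hk
    · rw [← mul_assoc, one_mul, ← neg_mul, neg_sub]
      exact mul_le_mul_of_nonneg_right (weight_le_of_le hk) (sq_nonneg _)
    · simp [hx k hk]

/-- A finite combination of more vectors than there are conditions can be chosen nonzero with all
the prescribed inner products zero. -/
theorem exists_combination_orthogonal {ι κ : Type*} [Fintype ι] [Fintype κ] (f : ι → H) (g : κ → H)
    (hcard : Fintype.card κ < Fintype.card ι) :
    ∃ c : ι → 𝕜, c ≠ 0 ∧ ∀ k, inner 𝕜 (g k) (∑ i, c i • f i) = 0 := by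
  let L : (ι → 𝕜) →ₗ[𝕜] (κ → 𝕜) :=
    LinearMap.pi fun k => (innerₛₗ 𝕜 (g k)).comp (Fintype.linearCombination 𝕜 f)
  have hL : LinearMap.ker L ≠ ⊥ := LinearMap.ker_ne_bot_of_finrank_lt (by simpa using hcard)
  obtain ⟨c, hc, hc0⟩ := Submodule.exists_mem_ne_zero_of_ne_bot hL
  refine ⟨c, hc0, fun k => ?_⟩
  have := congrFun (LinearMap.mem_ker.1 hc) k
  simpa [L, Fintype.linearCombination_apply] using this

theorem Orthonormal.sum_smul_ne_zero {ι : Type*} [Fintype ι] {f : ι → H} (hf : Orthonormal 𝕜 f)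
    {c : ι → 𝕜} (hc : c ≠ 0) : ∑ i, c i • f i ≠ 0 := fun h =>
  hc (funext (Fintype.linearIndependent_iff.1 hf.linearIndependent c h))

/-- `f` is an eigenvector of `T` with eigenvalue `μ` (or zero). -/
def IsEigenpair (T : H →ₗ.[𝕜] H) (μ : ℝ) (f : H) : Prop :=
  ∃ h : f ∈ T.domain, T ⟨f, h⟩ = (μ : 𝕜) • f

/-- There are at most `n + 1` eigenvalues below `n + 1/2`. -/
theorem SmallForm.card_le {n : ℕ} (h : SmallForm e R n) (hD : IsNumberOperator e D)
    {ι : Type*} [Fintype ι] {f : ι → H} {μ : ι → ℝ} (hf : Orthonormal 𝕜 f)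
    (hfμ : ∀ i, IsEigenpair (perturb D R) (μ i) (f i)) (hμ : ∀ i, μ i ≤ n + 1 / 2) :
    Fintype.card ι ≤ n + 1 := by
  classical
  by_contra! hcard
  -- More than `n + 1` eigenvectors have a nonzero combination orthogonal to `e 0, …, e n`, where
  -- the form of `T - (n + 1/2)` is positive; but it is nonpositive on these eigenvectors' span.
  obtain ⟨c, hc, hc'⟩ := exists_combination_orthogonal (𝕜 := 𝕜) f
    (fun k : Fin (n + 1) => e k) (by simpa using hcard)
  choose hdom hT using hfμ
  let x : (perturb D R).domain := ∑ i, c i • ⟨f i, hdom i⟩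
  have hx : (x : H) = ∑ i, c i • f i := by simp [x]
  refine Orthonormal.sum_smul_ne_zero hf hc (hx ▸ h.eq_zero_of_orthogonal hD x
    (fun k hk => hx ▸ hc' ⟨k, by omega⟩) ?_)
  have hTx : perturb D R x = ∑ i, ((μ i : 𝕜) * c i) • f i := by
    change (perturb D R).toFun x = _
    simp only [x, map_sum, map_smul]
    refine Finset.sum_congr rfl fun i _ => ?_
    have : (perturb D R).toFun ⟨f i, hdom i⟩ = (μ i : 𝕜) • f i := hT i
    rw [this, smul_smul, mul_comm]
  have hn : ‖(x : H)‖ ^ 2 = ∑ i, ‖c i‖ ^ 2 := by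
    rw [← inner_self_eq_norm_sq (𝕜 := 𝕜), hx, hf.inner_sum, map_sum]
    refine Finset.sum_congr rfl fun i _ => ?_
    rw [RCLike.conj_mul]
    norm_cast
  rw [hn, hTx, hx, hf.inner_sum, map_sum, Finset.mul_sum]
  refine Finset.sum_le_sum fun i _ => ?_
  rw [mul_left_comm, RCLike.conj_mul, RCLike.re_ofReal_mul]
  norm_cast
  exact mul_le_mul_of_nonneg_right (by simpa using hμ i) (sq_nonneg _)

/-- There are at least `n + 1` eigenvalues below `n + 1/2`. -/
theorem SmallForm.le_card [CompleteSpace H] {n : ℕ} (h : SmallForm e R n)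
    (hD : IsNumberOperator e D) (hR : IsSelfAdjoint R)
    {ι : Type*} (f : HilbertBasis ι 𝕜 H) {μ : ι → ℝ}
    (hfμ : ∀ i, IsEigenpair (perturb D R) (μ i) (f i)) (A : Finset ι)
    (hμ : ∀ i ∉ A, (n + 1 / 2 : ℝ) ≤ μ i) : n + 1 ≤ A.card := by
  classical
  by_contra! hcard
  have he : Orthonormal 𝕜 fun k : Fin (n + 1) => e k :=
    e.orthonormal.comp _ Fin.val_injective
  -- Dually, some nonzero combination of `e 0, …, e n` is orthogonal to every `f i` with `i ∈ A`, so
  -- expanding in `f` makes its form at least `(n + 1/2)‖x‖²`.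
  obtain ⟨c, hc, hc'⟩ := exists_combination_orthogonal (𝕜 := 𝕜)
    (fun k : Fin (n + 1) => e k) (fun i : A => f i) (by simpa using hcard)
  choose hdom hT using hfμ
  let x : (perturb D R).domain := ∑ k : Fin (n + 1), c k • ⟨e k, basis_mem_domain hD k⟩
  have hx : (x : H) = ∑ k : Fin (n + 1), c k • e k := by simp [x]
  refine Orthonormal.sum_smul_ne_zero he hc (hx ▸ h.eq_zero_of_mem_span hD x (fun k hk => ?_) ?_)
  · rw [hx, inner_sum]
    refine Finset.sum_eq_zero fun j _ => ?_
    rw [inner_smul_right, e.orthonormal.2 (by omega), mul_zero]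
  · have hs := RCLike.hasSum_re 𝕜 (f.hasSum_inner_mul_inner (x : H) (perturb D R x))
    refine hasSum_le (fun i => ?_) ((hasSum_sq_norm_inner f (x : H)).mul_left _) hs
    have h1 := perturb_symmetric hD hR ⟨f i, hdom i⟩ x
    rw [hT i, inner_smul_left, RCLike.conj_ofReal] at h1
    rw [← h1, mul_left_comm, ← inner_conj_symm (x : H), RCLike.conj_mul, RCLike.re_ofReal_mul]
    norm_cast
    by_cases hi : i ∈ A
    · have : inner 𝕜 (f i) (x : H) = 0 := hx ▸ hc' ⟨i, hi⟩
      simp [this]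
    · exact mul_le_mul_of_nonneg_right (by simpa using hμ i hi) (sq_nonneg _)

end

/-! ### Listing a family of reals in nondecreasing order. -/

section

/-- Order by the value of `μ`, ties being broken by a well-ordering of `ι`. -/
theorem exists_linearOrder_monotone {ι : Type*} (μ : ι → ℝ) :
    ∃ _ : LinearOrder ι, Monotone μ := by
  classical
  obtain ⟨F, hF, hFμ⟩ : ∃ F : ι → ℝ ×ₗ Ordinal, Function.Injective F ∧
      ∀ i j, F i ≤ F j → μ i ≤ μ j := by
    refine ⟨fun i => toLex (μ i, Ordinal.typein WellOrderingRel i), fun i j h =>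
      Ordinal.typein_injective _ (congrArg (fun p => (ofLex p).2) h), fun i j h => ?_⟩
    rcases Prod.Lex.le_iff.1 h with h | h
    · exact h.le
    · exact h.1.le
  exact ⟨LinearOrder.lift' F hF, hFμ⟩

/-- A family of reals with finite sublevel sets can be listed in nondecreasing order. -/
theorem exists_equiv_nat_monotone {ι : Type*} [Infinite ι] (μ : ι → ℝ)
    (hμ : ∀ z : ℝ, {i | μ i ≤ z}.Finite) : ∃ g : ℕ ≃ ι, Monotone fun n => μ (g n) := by
  obtain ⟨l, hl⟩ := exists_linearOrder_monotone μ
  -- Finite initial segments make the order locally finite with a least element; being infinite, `ι`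
  -- has no greatest one, so its order type is that of `ℕ`.
  have hfin : ∀ j : ι, (Set.Iic j).Finite := fun j => (hμ (μ j)).subset fun i hi => hl hi
  let _ := LocallyFiniteOrder.ofFiniteIcc fun a b : ι => (hfin b).subset fun _ h => h.2
  let _ := LinearLocallyFiniteOrder.succOrder ι
  let _ := LinearLocallyFiniteOrder.predOrder ι
  have : NoMaxOrder ι := ⟨fun a => by
    obtain ⟨b, hb⟩ := (hfin a).infinite_compl.nonempty
    exact ⟨b, not_le.1 hb⟩⟩
  obtain ⟨i₀⟩ : Nonempty ι := inferInstance
  obtain ⟨b, hb, hmin⟩ := Set.exists_min_image (Set.Iic i₀) id (hfin i₀) ⟨i₀, le_rfl⟩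
  let _ : OrderBot ι :=
    { bot := b
      bot_le := fun a => (le_total a i₀).elim (hmin a) fun h => le_trans hb h }
  let g : ι ≃o ℕ := orderIsoNatOfLinearSuccPredArch
  exact ⟨g.symm.toEquiv, fun m n hmn => hl (g.symm.monotone hmn)⟩

/-! ### The compact resolvent and the Fredholm alternative. -/

variable {𝕜 : Type*} [RCLike 𝕜] {H : Type*} [NormedAddCommGroup H] [InnerProductSpace 𝕜 H]
  {e : HilbertBasis ℕ 𝕜 H} {D : H →ₗ.[𝕜] H} {R : H →L[𝕜] H}

/-- The partial sums of the expansion of `(D + c)⁻¹`. -/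
noncomputable def partialResolvent (e : HilbertBasis ℕ 𝕜 H) (c : ℝ) (N : ℕ) : H →L[𝕜] H :=
  ∑ k ∈ Finset.range N, ((((k : ℝ) + c)⁻¹ : ℝ) : 𝕜) • InnerProductSpace.rankOne 𝕜 (e k) (e k)

theorem inner_partialResolvent (c : ℝ) (N : ℕ) (x : H) (k : ℕ) :
    inner 𝕜 (e k) (partialResolvent e c N x) =
      if k < N then ((((k : ℝ) + c)⁻¹ : ℝ) : 𝕜) * inner 𝕜 (e k) x else 0 := by
  have : partialResolvent e c N x =
      ∑ j ∈ Finset.range N, (((((j : ℝ) + c)⁻¹ : ℝ) : 𝕜) * inner 𝕜 (e j) x) • e j := by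
    simp [partialResolvent, smul_smul]
  rw [this, inner_sum_smul]
  simp only [Finset.mem_range]

theorem isCompactOperator_partialResolvent (c : ℝ) (N : ℕ) :
    IsCompactOperator (partialResolvent e c N) := by
  rw [partialResolvent]
  refine Finset.sum_induction _ (fun A : H →L[𝕜] H => IsCompactOperator A)
    (fun A B hA hB => hA.add hB) isCompactOperator_zero fun k _ => ?_
  have h : IsCompactOperator (InnerProductSpace.rankOne 𝕜 (e k) (e k)) := by
    rw [InnerProductSpace.rankOne_def']
    exact IsCompactOperator.clm_comp
      (isCompactOperator_of_locallyCompactSpace_dom (innerSL 𝕜 (e k)))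
      (ContinuousLinearMap.toSpanSingleton 𝕜 (e k))
  exact h.smul _

theorem norm_le_of_norm_inner_le {x y : H} {C : ℝ} (hC : 0 ≤ C)
    (h : ∀ k, ‖inner 𝕜 (e k) y‖ ≤ C * ‖inner 𝕜 (e k) x‖) : ‖y‖ ≤ C * ‖x‖ := by
  refine le_of_sq_le_sq ?_ (by positivity)
  rw [mul_pow]
  refine hasSum_le (fun k => ?_) (hasSum_sq_norm_inner e y)
    ((hasSum_sq_norm_inner e x).mul_left (C ^ 2))
  rw [← mul_pow]
  gcongr
  exact h k

/-- The operator `(D + c)⁻¹` of the number operator `D` is compact, with norm at most `1 / c`. -/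
theorem exists_diagonal_resolvent [CompleteSpace H] (e : HilbertBasis ℕ 𝕜 H) {c : ℝ} (hc : 0 < c) :
    ∃ G : H →L[𝕜] H, IsCompactOperator G ∧ ‖G‖ ≤ c⁻¹ ∧
      ∀ x k, inner 𝕜 (e k) (G x) = ((((k : ℝ) + c)⁻¹ : ℝ) : 𝕜) * inner 𝕜 (e k) x := by
  have hcauchy : CauchySeq (partialResolvent e c) := by
    refine cauchySeq_of_le_tendsto_0 (fun N : ℕ => ((N : ℝ) + c)⁻¹) (fun n m N hn hm => ?_) ?_
    · rw [dist_eq_norm]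
      refine ContinuousLinearMap.opNorm_le_bound _ (by positivity) fun x => ?_
      refine norm_le_of_norm_inner_le (e := e) (by positivity) fun k => ?_
      rw [sub_apply, inner_sub_right, inner_partialResolvent,
        inner_partialResolvent]
      have hk : N ≤ k → ‖((((k : ℝ) + c)⁻¹ : ℝ) : 𝕜) * inner 𝕜 (e k) x‖ ≤
          ((N : ℝ) + c)⁻¹ * ‖inner 𝕜 (e k) x‖ := fun hk => by
        rw [norm_mul, RCLike.norm_ofReal, abs_of_nonneg (by positivity)]
        gcongr
      have h0 : 0 ≤ ((N : ℝ) + c)⁻¹ * ‖inner 𝕜 (e k) x‖ := by positivity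
      split_ifs
      · simpa using h0
      · rw [sub_zero]
        exact hk (by omega)
      · rw [zero_sub, norm_neg]
        exact hk (by omega)
      · simpa using h0
    · exact tendsto_inv_atTop_zero.comp (tendsto_natCast_atTop_atTop.atTop_add tendsto_const_nhds)
  obtain ⟨G, hG⟩ := cauchySeq_tendsto_of_complete hcauchy
  have hcoord : ∀ x k, inner 𝕜 (e k) (G x) = ((((k : ℝ) + c)⁻¹ : ℝ) : 𝕜) * inner 𝕜 (e k) x := by
    intro x k
    have h1 : Tendsto (fun N => inner 𝕜 (e k) (partialResolvent e c N x)) atTop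
        (𝓝 (inner 𝕜 (e k) (G x))) :=
      ((continuous_const.inner continuous_id).tendsto _).comp
        (((ContinuousLinearMap.apply 𝕜 H x).continuous.tendsto G).comp hG)
    refine tendsto_nhds_unique h1 (tendsto_const_nhds.congr' ?_)
    filter_upwards [eventually_gt_atTop k] with N hN
    rw [inner_partialResolvent, if_pos hN]
  refine ⟨G, isCompactOperator_of_tendsto hG
    (Eventually.of_forall fun N => isCompactOperator_partialResolvent c N), ?_, hcoord⟩
  refine ContinuousLinearMap.opNorm_le_bound _ (by positivity) fun x => ?_
  refine norm_le_of_norm_inner_le (e := e) (by positivity) fun k => ?_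
  rw [hcoord, norm_mul, RCLike.norm_ofReal, abs_of_nonneg (by positivity)]
  gcongr
  linarith [k.cast_nonneg (α := ℝ)]

/-- `S` is a compact symmetric inverse of `T + c`. -/
structure IsCompactResolvent (T : H →ₗ.[𝕜] H) (c : 𝕜) (S : H →L[𝕜] H) : Prop where
  compact : IsCompactOperator S
  symmetric : S.IsSymmetric
  right_inv : ∀ y, ∃ h : S y ∈ T.domain, T ⟨S y, h⟩ + c • S y = y
  left_inv : ∀ x : T.domain, S (T x + c • (x : H)) = x

/-- Factor `T + c = (1 + R G)(D + c)` with `G = (D + c)⁻¹`. For `c = ‖R‖ + 1` one has `‖R G‖ < 1`,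
so a Neumann series inverts `1 + R G`, and `G (1 + R G)⁻¹` is compact because `G` is. -/
theorem exists_isCompactResolvent [CompleteSpace H] (hD : IsNumberOperator e D)
    (hR : IsSelfAdjoint R) : ∃ (c : 𝕜) (S : H →L[𝕜] H), IsCompactResolvent (perturb D R) c S := by
  set c : ℝ := ‖R‖ + 1
  have hc : 0 < c := by positivity
  obtain ⟨G, hGc, hGn, hG⟩ := exists_diagonal_resolvent e hc
  have hsmall : ‖-(R * G)‖ < 1 := by
    rw [norm_neg]
    calc ‖R * G‖ ≤ ‖R‖ * c⁻¹ := (norm_mul_le _ _).trans (by gcongr)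
      _ < 1 := by
        rw [← div_eq_mul_inv, div_lt_one hc]
        exact lt_add_one _
  obtain ⟨u, hu⟩ := isUnit_one_sub_of_norm_lt_one hsmall
  rw [sub_neg_eq_add] at hu
  set B : H →L[𝕜] H := ↑u⁻¹
  have hB1 : ∀ y, B y + R (G (B y)) = y := fun y => by
    have h : (u : H →L[𝕜] H) * B = 1 := u.mul_inv
    rw [hu] at h
    simpa using congrArg (fun A : H →L[𝕜] H => A y) h
  have hB2 : ∀ y, B (y + R (G y)) = y := fun y => by
    have h : B * (u : H →L[𝕜] H) = 1 := u.inv_mul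
    rw [hu] at h
    simpa using congrArg (fun A : H →L[𝕜] H => A y) h
  have hck : ∀ k : ℕ, ((k : 𝕜) + (c : 𝕜)) * ((((k : ℝ) + c)⁻¹ : ℝ) : 𝕜) = 1 := fun k => by
    have h : ((k : ℝ) + c) * ((k : ℝ) + c)⁻¹ = 1 := mul_inv_cancel₀ (by positivity)
    exact_mod_cast congrArg (fun r : ℝ => (r : 𝕜)) h
  have hright : ∀ y, ∃ h : G (B y) ∈ (perturb D R).domain,
      perturb D R ⟨G (B y), h⟩ + (c : 𝕜) • G (B y) = y := by
    intro y
    obtain ⟨h, hT⟩ := (exists_perturb_eq_iff (R := R) hD (G (B y)) (y - (c : 𝕜) • G (B y))).2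
      fun k => by
        have h1 := hck k
        rw [inner_sub_right, inner_smul_right, sub_eq_iff_eq_add]
        conv_lhs => rw [← hB1 y]
        rw [inner_add_right, hG]
        linear_combination -(inner 𝕜 (e k) (B y)) * h1
    exact ⟨h, by rw [hT, sub_add_cancel]⟩
  have hleft : ∀ x : (perturb D R).domain,
      G (B (perturb D R x + (c : 𝕜) • (x : H))) = x := by
    intro x
    -- Here `w` is `(D + c) x`.
    obtain ⟨w, hw⟩ : ∃ w, w = perturb D R x + (c : 𝕜) • (x : H) - R x := ⟨_, rfl⟩
    have hGw : G w = x := by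
      refine ext_inner_basis e fun k => ?_
      rw [hG, hw, inner_sub_right, inner_add_right, inner_smul_right, inner_perturb hD]
      linear_combination (inner 𝕜 (e k) (x : H)) * hck k
    have : perturb D R x + (c : 𝕜) • (x : H) = w + R (G w) := by
      rw [hGw, hw, sub_add_cancel]
    rw [this, hB2, hGw]
  refine ⟨c, G ∘L B, hGc.comp_clm B, fun y z => ?_, hright, hleft⟩
  change inner 𝕜 (G (B y)) z = inner 𝕜 y (G (B z))
  obtain ⟨hy, hy'⟩ := hright y
  obtain ⟨hz, hz'⟩ := hright z
  have hsym := perturb_symmetric hD hR ⟨G (B y), hy⟩ ⟨G (B z), hz⟩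
  conv_lhs => rw [← hz']
  conv_rhs => rw [← hy']
  rw [inner_add_left, inner_add_right, hsym, inner_smul_left, inner_smul_right, RCLike.conj_ofReal]

variable {T : H →ₗ.[𝕜] H} {c : 𝕜} {S : H →L[𝕜] H}

theorem IsCompactResolvent.apply_eigenvector (hS : IsCompactResolvent T c S) {μ : 𝕜} {x : T.domain}
    (hx : x ∈ eigenspace T μ) : (μ + c) • S x = x := by
  have h := hS.left_inv x
  rwa [mem_eigenspace_iff.1 hx, ← add_smul, map_smul] at h

theorem IsCompactResolvent.mem_eigenspace (hS : IsCompactResolvent T c S) {ν : 𝕜} (hν : ν ≠ 0)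
    {v : H} (hv : S v = ν • v) : ∃ h : v ∈ T.domain, ⟨v, h⟩ ∈ eigenspace T (ν⁻¹ - c) := by
  obtain ⟨h, hT⟩ := hS.right_inv (ν⁻¹ • v)
  have h1 : S (ν⁻¹ • v) = v := by rw [map_smul, hv, inv_smul_smul₀ hν]
  simp only [h1] at h hT
  exact ⟨h, mem_eigenspace_iff.2 (by rw [sub_smul]; exact eq_sub_of_add_eq hT)⟩

/-- The eigenspace embeds in that of the compact operator `S` at `(μ + c)⁻¹`; when `μ = -c` it is
zero, since `T + c` is injective. -/
theorem IsCompactResolvent.finiteDimensional_eigenspace [CompleteSpace H]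
    (hS : IsCompactResolvent T c S) (μ : 𝕜) : FiniteDimensional 𝕜 (eigenspace T μ) := by
  have hx : ∀ x : eigenspace T μ, (μ + c) • S ((x : T.domain) : H) = ((x : T.domain) : H) :=
    fun x => hS.apply_eigenvector x.2
  by_cases h : μ + c = 0
  · have : Subsingleton (eigenspace T μ) := ⟨fun x y => Subtype.ext (Subtype.ext (by
      rw [← hx x, ← hx y, h, zero_smul, zero_smul]))⟩
    infer_instance
  · have := ContinuousLinearMap.finite_dimensional_eigenspace hS.compact (μ + c)⁻¹ (inv_ne_zero h)
    let L : eigenspace T μ →ₗ[𝕜] H := T.domain.subtype ∘ₗ (eigenspace T μ).subtype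
    have hL : ∀ x, L x ∈ Module.End.eigenspace S.toLinearMap (μ + c)⁻¹ := fun x => by
      rw [Module.End.mem_eigenspace_iff]
      exact (eq_inv_smul_iff₀ h).2 (hx x)
    refine FiniteDimensional.of_injective (L.codRestrict _ hL) fun x y hxy => ?_
    have h := congrArg
      (fun z : Module.End.eigenspace S.toLinearMap (μ + c)⁻¹ => (z : H)) hxy
    exact Subtype.ext (Subtype.ext h)

/-- The eigenvectors of an operator with compact resolvent are total. -/
theorem IsCompactResolvent.eq_zero_of_orthogonal [CompleteSpace H]
    (hS : IsCompactResolvent T c S) {v : H}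
    (hv : ∀ (μ : 𝕜), ∀ x ∈ eigenspace T μ, inner 𝕜 (x : H) v = 0) : v = 0 := by
  have h := ContinuousLinearMap.orthogonalComplement_iSup_eigenspaces_eq_bot hS.compact hS.symmetric
  rw [← Submodule.mem_bot (R := 𝕜), ← h, ← Submodule.iInf_orthogonal, Submodule.mem_iInf]
  intro ν
  rw [Submodule.mem_orthogonal]
  intro x hx
  rw [Module.End.mem_eigenspace_iff] at hx
  change S x = ν • x at hx
  rcases eq_or_ne ν 0 with rfl | hν
  · obtain ⟨hd, hT⟩ := hS.right_inv x
    rw [zero_smul] at hx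
    have h0 : (⟨S x, hd⟩ : T.domain) = 0 := Subtype.ext hx
    rw [h0, hx, smul_zero, add_zero, LinearPMap.map_zero] at hT
    rw [← hT, inner_zero_left]
  · obtain ⟨hd, hx'⟩ := hS.mem_eigenspace hν hx
    exact hv _ _ hx'

/-- The Fredholm alternative: the spectrum consists of eigenvalues. -/
theorem IsCompactResolvent.eigenspace_ne_bot [CompleteSpace H]
    (hS : IsCompactResolvent T c S) {μ : 𝕜} (hμ : μ ∈ spectrum T) : eigenspace T μ ≠ ⊥ := by
  -- At `μ = -c` the operator `S` itself is the resolvent.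
  have hμc : μ + c ≠ 0 := by
    intro h
    obtain rfl := eq_neg_of_add_eq_zero_left h
    refine hμ ⟨S, fun y => ?_, fun x => ?_⟩
    · obtain ⟨hd, hT⟩ := hS.right_inv y
      exact ⟨hd, by rw [shift_apply, neg_smul, sub_neg_eq_add]; exact hT⟩
    · rw [shift_apply, neg_smul, sub_neg_eq_add]
      exact hS.left_inv x
  rcases hS.compact.hasEigenvalue_or_mem_resolventSet (inv_ne_zero hμc) with h | h
  · obtain ⟨v, hv, hv0⟩ := h.exists_hasEigenvector
    obtain ⟨hd, hx⟩ := hS.mem_eigenspace (inv_ne_zero hμc) (Module.End.mem_eigenspace_iff.1 hv)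
    rw [inv_inv, add_sub_cancel_right] at hx
    exact (Submodule.ne_bot_iff _).2 ⟨_, hx, fun h0 => hv0 (congrArg Subtype.val h0)⟩
  · exfalso
    obtain ⟨u, hu⟩ := _root_.spectrum.mem_resolventSet_iff.1 h
    set B : H →L[𝕜] H := ↑u⁻¹
    have hB1 : ∀ y, (μ + c)⁻¹ • B y - S (B y) = y := fun y => by
      have h : (u : H →L[𝕜] H) * B = 1 := u.mul_inv
      rw [hu] at h
      simpa [Algebra.algebraMap_eq_smul_one] using congrArg (fun A : H →L[𝕜] H => A y) h
    have hB2 : ∀ y, B ((μ + c)⁻¹ • y - S y) = y := fun y => by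
      have h : B * (u : H →L[𝕜] H) = 1 := u.inv_mul
      rw [hu] at h
      simpa [Algebra.algebraMap_eq_smul_one] using congrArg (fun A : H →L[𝕜] H => A y) h
    -- The factorization `T - μ = (μ + c) ((μ + c)⁻¹ - S) (T + c)` reduces inverting `T - μ` to
    -- inverting `(μ + c)⁻¹ - S`.
    have hshift : ∀ x : T.domain, shift T μ x =
        (μ + c) • ((μ + c)⁻¹ • (T x + c • (x : H)) - S (T x + c • (x : H))) := fun x => by
      rw [shift_apply, hS.left_inv, smul_sub, smul_inv_smul₀ hμc]
      module
    refine hμ ⟨S ∘L ((μ + c)⁻¹ • B), fun y => ?_, fun x => ?_⟩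
    · obtain ⟨hd, hT⟩ := hS.right_inv ((μ + c)⁻¹ • B y)
      refine ⟨hd, ?_⟩
      have := hshift ⟨_, hd⟩
      simp only [hT] at this
      refine this.trans ?_
      rw [map_smul, ← smul_sub, hB1, smul_inv_smul₀ hμc]
    · rw [hshift]
      change S ((μ + c)⁻¹ • B ((μ + c) • _)) = _
      rw [map_smul B, inv_smul_smul₀ hμc, hB2, hS.left_inv]

end

/-! ### Enumerations of eigenvalues and bases of eigenvectors. -/

section

variable {𝕜 : Type*} [RCLike 𝕜] {H : Type*} [NormedAddCommGroup H] [InnerProductSpace 𝕜 H]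
  {T : H →ₗ.[𝕜] H} {c : 𝕜} {S : H →L[𝕜] H}

theorem isEigenpair_of_mem_eigenspace {μ : ℝ} {x : T.domain} (hx : x ∈ eigenspace T (μ : 𝕜)) :
    IsEigenpair T μ (x : H) :=
  ⟨x.2, mem_eigenspace_iff.1 hx⟩

theorem conj_mul_inner_eq_of_mem_eigenspace
    (hT : ∀ x y : T.domain, inner 𝕜 (T x) (y : H) = inner 𝕜 (x : H) (T y)) {μ ν : 𝕜}
    {x y : T.domain} (hx : x ∈ eigenspace T μ) (hy : y ∈ eigenspace T ν) :
    (starRingEnd 𝕜) μ * inner 𝕜 (x : H) (y : H) = ν * inner 𝕜 (x : H) (y : H) := by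
  have h := hT x y
  rwa [mem_eigenspace_iff.1 hx, mem_eigenspace_iff.1 hy, inner_smul_left, inner_smul_right] at h

theorem ofReal_re_eq_of_eigenspace_ne_bot
    (hT : ∀ x y : T.domain, inner 𝕜 (T x) (y : H) = inner 𝕜 (x : H) (T y)) {μ : 𝕜}
    (hμ : eigenspace T μ ≠ ⊥) : ((RCLike.re μ : ℝ) : 𝕜) = μ := by
  obtain ⟨x, hx, hx0⟩ := (Submodule.ne_bot_iff _).1 hμ
  rw [← RCLike.conj_eq_iff_re]
  refine mul_right_cancel₀ ?_ (conj_mul_inner_eq_of_mem_eigenspace hT hx hx)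
  exact inner_self_ne_zero.2 fun h => hx0 (Subtype.ext h)

theorem inner_eq_zero_of_mem_eigenspace
    (hT : ∀ x y : T.domain, inner 𝕜 (T x) (y : H) = inner 𝕜 (x : H) (T y)) {μ ν : ℝ}
    (hμν : μ ≠ ν) {x y : T.domain} (hx : x ∈ eigenspace T (μ : 𝕜))
    (hy : y ∈ eigenspace T (ν : 𝕜)) : inner 𝕜 (x : H) (y : H) = 0 := by
  have h := conj_mul_inner_eq_of_mem_eigenspace hT hx hy
  rw [RCLike.conj_ofReal, ← sub_eq_zero, ← sub_mul, mul_eq_zero, sub_eq_zero] at h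
  exact h.resolve_left fun h' => hμν (RCLike.ofReal_injective h')

/-- The vectors of orthonormal bases of all the eigenspaces are total. -/
theorem IsCompactResolvent.eq_zero_of_orthogonal_bases [CompleteSpace H]
    (hS : IsCompactResolvent T c S)
    (hT : ∀ x y : T.domain, inner 𝕜 (T x) (y : H) = inner 𝕜 (x : H) (T y))
    {ι : ℝ → Type*} [∀ μ, Fintype (ι μ)]
    (b : ∀ μ : ℝ, OrthonormalBasis (ι μ) 𝕜 (eigenspace T (μ : 𝕜))) {v : H}
    (hv : ∀ μ i, inner 𝕜 v ((b μ i : T.domain) : H) = 0) : v = 0 := by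
  have key : ∀ μ : ℝ, ∀ x : eigenspace T (μ : 𝕜), inner 𝕜 v ((x : T.domain) : H) = 0 := by
    intro μ x
    have h : (innerₛₗ 𝕜 v) ∘ₗ T.domain.subtype ∘ₗ (eigenspace T (μ : 𝕜)).subtype = 0 :=
      (b μ).toBasis.ext fun i => by simpa using hv μ i
    exact LinearMap.congr_fun h x
  refine hS.eq_zero_of_orthogonal fun μ x hx => ?_
  by_cases hμ : eigenspace T μ = ⊥
  · rw [hμ, Submodule.mem_bot] at hx
    rw [hx]
    exact inner_zero_left v
  · obtain ⟨r, rfl⟩ : ∃ r : ℝ, (r : 𝕜) = μ := ⟨_, ofReal_re_eq_of_eigenspace_ne_bot hT hμ⟩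
    exact inner_eq_zero_symm.1 (key r ⟨x, hx⟩)

/-- Every real number has only finitely many eigenvalues below it, with multiplicity. -/
def HasFiniteCounting (T : H →ₗ.[𝕜] H) : Prop :=
  ∀ z : ℝ, ∃ N : ℕ, ∀ (ι : Type) [Fintype ι] (f : ι → H) (μ : ι → ℝ), Orthonormal 𝕜 f →
    (∀ i, IsEigenpair T (μ i) (f i)) → (∀ i, μ i ≤ z) → Fintype.card ι ≤ N

theorem HasFiniteCounting.finite (h : HasFiniteCounting T) {ι : Type*} {f : ι → H} {μ : ι → ℝ}
    (hf : Orthonormal 𝕜 f) (hμ : ∀ i, IsEigenpair T (μ i) (f i)) (z : ℝ) :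
    {i | μ i ≤ z}.Finite := by
  by_contra hinf
  obtain ⟨N, hN⟩ := h z
  obtain ⟨A, hA, hAcard⟩ := Set.Infinite.exists_subset_card_eq hinf (N + 1)
  let g : Fin (N + 1) ≃ A := (A.equivFinOfCardEq hAcard).symm
  have := hN (Fin (N + 1)) (fun i => f (g i)) (fun i => μ (g i))
    (hf.comp _ (Subtype.val_injective.comp g.injective)) (fun i => hμ _) (fun i => hA (g i).2)
  simp at this

/-- Collect orthonormal bases of all real eigenspaces into one orthonormal family. Its sublevel sets
are finite, and it is infinite because it is total in an infinite-dimensional space, so it can be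
listed; the fibre of the list over `r` has the size of the basis at `r`. -/
theorem exists_isEigenvalueEnumeration [CompleteSpace H] (e : HilbertBasis ℕ 𝕜 H)
    (hS : IsCompactResolvent T c S)
    (hT : ∀ x y : T.domain, inner 𝕜 (T x) (y : H) = inner 𝕜 (x : H) (T y))
    (hfin : HasFiniteCounting T) : ∃ lam : ℕ → ℝ, IsEigenvalueEnumeration T lam := by
  have := hS.finiteDimensional_eigenspace
  let b := fun μ : ℝ => stdOrthonormalBasis 𝕜 (eigenspace T (μ : 𝕜))
  let ι := Σ μ : ℝ, Fin (Module.finrank 𝕜 (eigenspace T (μ : 𝕜)))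
  let f : ι → H := fun i => ((b i.1 i.2 : T.domain) : H)
  have hf : Orthonormal 𝕜 f := by
    refine ⟨fun i => (b i.1).orthonormal.1 i.2, ?_⟩
    rintro ⟨μ, i⟩ ⟨ν, j⟩ hij
    by_cases h : μ = ν
    · subst h
      exact (b μ).orthonormal.2 fun h => hij (congrArg (Sigma.mk μ) h)
    · exact inner_eq_zero_of_mem_eigenspace hT h (b μ i).2 (b ν j).2
  have hsub : ∀ z : ℝ, {i : ι | i.1 ≤ z}.Finite := fun z =>
    hfin.finite hf (fun i => isEigenpair_of_mem_eigenspace (b i.1 i.2).2) z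
  have hinf : Infinite ι := by
    by_contra h
    rw [not_infinite_iff_finite] at h
    have := Fintype.ofFinite ι
    obtain ⟨d, hd, hd'⟩ := exists_combination_orthogonal (𝕜 := 𝕜)
      (fun k : Fin (Fintype.card ι + 1) => e k) f (by simp)
    refine Orthonormal.sum_smul_ne_zero (e.orthonormal.comp _ Fin.val_injective) hd ?_
    exact hS.eq_zero_of_orthogonal_bases hT b fun μ i => inner_eq_zero_symm.1 (hd' ⟨μ, i⟩)
  obtain ⟨g, hg⟩ := exists_equiv_nat_monotone (fun i : ι => i.1) hsub
  refine ⟨fun n => (g n).1, hg, fun μ => ⟨this μ, ?_⟩⟩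
  by_cases hμ : ∃ r : ℝ, (r : 𝕜) = μ
  · obtain ⟨r, rfl⟩ := hμ
    have h : {n : ℕ | (((g n).1 : ℝ) : 𝕜) = (r : 𝕜)} = g.symm '' Set.range (Sigma.mk r) := by
      ext n
      rw [Equiv.image_symm_eq_preimage]
      constructor
      · intro h
        obtain rfl := RCLike.ofReal_injective h
        exact ⟨(g n).2, rfl⟩
      · rintro ⟨i, hi⟩
        change (((g n).1 : ℝ) : 𝕜) = (r : 𝕜)
        rw [← hi]
    rw [h, g.symm.injective.encard_image, ← Set.image_univ, sigma_mk_injective.encard_image,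
      Set.encard_univ]
    simp
  · have h : eigenspace T μ = ⊥ := by
      by_contra h
      exact hμ ⟨_, ofReal_re_eq_of_eigenspace_ne_bot hT h⟩
    have h' : {n : ℕ | (((g n).1 : ℝ) : 𝕜) = μ} = ∅ :=
      Set.eq_empty_of_forall_notMem fun n hn => hμ ⟨_, hn⟩
    rw [h, h', Set.encard_empty, finrank_bot, Nat.cast_zero]

/-- There is a Hilbert basis of eigenvectors matching any enumeration of the eigenvalues. -/
theorem IsEigenvalueEnumeration.exists_hilbertBasis [CompleteSpace H]
    (hS : IsCompactResolvent T c S)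
    (hT : ∀ x y : T.domain, inner 𝕜 (T x) (y : H) = inner 𝕜 (x : H) (T y))
    {lam : ℕ → ℝ} (hlam : IsEigenvalueEnumeration T lam) :
    ∃ f : HilbertBasis ℕ 𝕜 H, ∀ n, IsEigenpair T (lam n) (f n) := by
  have := fun μ => (hlam.2 μ).1
  let b := fun μ : ℝ => stdOrthonormalBasis 𝕜 (eigenspace T (μ : 𝕜))
  -- The enumeration repeats `μ` as often as the dimension of its eigenspace, so the indices with
  -- value `μ` can label an orthonormal basis of it.
  have hφ : ∀ μ : ℝ, Nonempty
      ({n : ℕ | lam n = μ} ≃ Fin (Module.finrank 𝕜 (eigenspace T (μ : 𝕜)))) := by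
    intro μ
    have h := (hlam.2 (μ : 𝕜)).2
    simp only [RCLike.ofReal_inj] at h
    have hfin : Finite {n : ℕ | lam n = μ} := Set.finite_of_encard_eq_coe h
    refine ⟨Finite.equivFinOfCardEq ?_⟩
    rw [Nat.card_coe_set_eq, Set.ncard, h, ENat.toNat_natCast]
  let φ := fun μ => (hφ μ).some
  let f : ℕ → H := fun n => ((b (lam n) (φ (lam n) ⟨n, rfl⟩) : T.domain) : H)
  -- Lets indices with equal eigenvalues be compared inside one and the same basis.
  have hfb : ∀ (μ : ℝ) (n : ℕ) (h : lam n = μ), f n = ((b μ (φ μ ⟨n, h⟩) : T.domain) : H) := by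
    rintro _ n rfl
    rfl
  have hmem : ∀ n, IsEigenpair T (lam n) (f n) :=
    fun n => isEigenpair_of_mem_eigenspace (b (lam n) (φ (lam n) ⟨n, rfl⟩)).2
  have hf : Orthonormal 𝕜 f := by
    refine ⟨fun n => (b (lam n)).orthonormal.1 _, fun m n hmn => ?_⟩
    by_cases h : lam m = lam n
    · change inner 𝕜 (f m) (f n) = 0
      rw [hfb _ m h, hfb _ n rfl]
      refine (b (lam n)).orthonormal.2 fun h' => hmn ?_
      exact congrArg Subtype.val ((φ (lam n)).injective h')
    · exact inner_eq_zero_of_mem_eigenspace hT h (b (lam m) _).2 (b (lam n) _).2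
  have htotal : (Submodule.span 𝕜 (Set.range f))ᗮ = ⊥ := by
    refine (Submodule.eq_bot_iff _).2 fun v hv => ?_
    refine hS.eq_zero_of_orthogonal_bases hT b fun μ i => ?_
    have h := hfb μ ((φ μ).symm i) ((φ μ).symm i).2
    rw [Subtype.coe_eta, Equiv.apply_symm_apply] at h
    rw [← h]
    exact Submodule.inner_left_of_mem_orthogonal (Submodule.subset_span (Set.mem_range_self _)) hv
  refine ⟨HilbertBasis.mkOfOrthogonalEqBot hf htotal, fun n => ?_⟩
  rw [HilbertBasis.coe_mkOfOrthogonalEqBot]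
  exact hmem n

variable {e : HilbertBasis ℕ 𝕜 H} {D : H →ₗ.[𝕜] H} {R : H →L[𝕜] H}

theorem hasFiniteCounting (hD : IsNumberOperator e D) (h : ∀ᶠ n in atTop, SmallForm e R n) :
    HasFiniteCounting (perturb D R) := by
  intro z
  obtain ⟨n, hn, hz⟩ := (h.and (eventually_ge_atTop ⌈z⌉₊)).exists
  refine ⟨n + 1, fun ι _ f μ hf hμ hle => hn.card_le hD hf hμ fun i => ?_⟩
  have := Nat.ceil_le.1 hz
  linarith [hle i]

/-- The numbers `n + 1/2` separate consecutive eigenvalues. -/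
theorem SmallForm.eigenvalue_lt_and_lt [CompleteSpace H] {n : ℕ} (h : SmallForm e R n)
    (hD : IsNumberOperator e D) (hR : IsSelfAdjoint R) {lam : ℕ → ℝ} (hlam : Monotone lam)
    (f : HilbertBasis ℕ 𝕜 H) (hf : ∀ n, IsEigenpair (perturb D R) (lam n) (f n)) :
    lam n < n + 1 / 2 ∧ n + 1 / 2 < lam (n + 1) := by
  -- If `lam n ≥ n + 1/2`, only the `n` indices in `range n` can lie below; if `lam (n + 1) ≤ n +
  -- 1/2`, there are `n + 2` below. The count must be `n + 1`.
  constructor <;> by_contra! hn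
  · have := h.le_card hD hR f hf (Finset.range n) fun i hi =>
      hn.trans (hlam (by simpa using hi))
    simp at this
  · have := h.card_le hD (ι := Fin (n + 2)) (f := fun i => f i) (μ := fun i => lam i)
      (f.orthonormal.comp _ Fin.val_injective) (fun i => hf i)
      fun i => (hlam (by omega)).trans hn
    simp at this

end

/-! ### The remainder `s_n` and the eigenvalue asymptotics. -/

section

variable {𝕜 : Type*} [RCLike 𝕜] {H : Type*} [NormedAddCommGroup H] [InnerProductSpace 𝕜 H]
  {e : HilbertBasis ℕ 𝕜 H} {D : H →ₗ.[𝕜] H} {R : H →L[𝕜] H}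

theorem weight_le_two_mul_sq {n k : ℕ} (h : k ≠ n) : weight n k ≤ 2 * ((n : ℝ) - k) ^ 2 := by
  have h1 : (1 : ℤ) ≤ |(n : ℤ) - k| := Int.one_le_abs (by omega)
  have h2 : (1 : ℝ) ≤ |(n : ℝ) - k| := by exact_mod_cast h1
  rw [weight, abs_sub_comm, ← sq_abs]
  nlinarith

/-- For a partial sum `P` of `s_n²`, test the form of `R` on `e n` and `y = ∑ R_{k,n} (n - k)⁻² e
k`. Then `⟨y, R (e n)⟩ = P`, while the energies are `1` and at most `2P`, so `P ≤ (δ/2) √(2P)`, that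
is `P ≤ δ²/2`. -/
theorem tendsto_remainder
    (hlim : ∀ p : ℤ, Tendsto (fun n : ℕ => entry e R n ((n : ℤ) + p).toNat) atTop (𝓝 0)) :
    Tendsto (remainder e R) atTop (𝓝 0) := by
  rw [Metric.tendsto_atTop']
  intro δ hδ
  obtain ⟨N, hN⟩ := eventually_atTop.1 (eventually_norm_inner_le hlim (ε := δ / 2) (by positivity))
  refine ⟨N, fun n hn => ?_⟩
  rw [Real.dist_0_eq_abs, remainder, abs_of_nonneg (Real.sqrt_nonneg _), Real.sqrt_lt' hδ]
  suffices h : ∑' k : {k : ℕ // k ≠ n}, ‖entry e R k n‖ ^ 2 / ((n : ℝ) - (k : ℕ)) ^ 2 ≤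
      2 * (δ / 2) ^ 2 by nlinarith
  refine (summable_remainder e R n).tsum_le_of_sum_le fun F => ?_
  let A : Finset ℕ := F.map (Function.Embedding.subtype _)
  have hA : ∀ k ∈ A, k ≠ n := fun k hk => by
    obtain ⟨j, _, rfl⟩ := Finset.mem_map.1 hk
    exact j.2
  set P := ∑ k ∈ F, ‖entry e R k n‖ ^ 2 / ((n : ℝ) - (k : ℕ)) ^ 2 with hP
  have hP' : P = ∑ k ∈ A, ‖entry e R k n‖ ^ 2 / ((n : ℝ) - k) ^ 2 := by
    rw [Finset.sum_map]
    rfl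
  have hP0 : 0 ≤ P := Finset.sum_nonneg fun k _ => by positivity
  let y : H := ∑ k ∈ A, (entry e R k n / (((n : ℝ) - k) ^ 2 : ℝ)) • e k
  have hy : ∀ k, inner 𝕜 (e k) y =
      if k ∈ A then entry e R k n / (((n : ℝ) - k) ^ 2 : ℝ) else 0 := inner_sum_smul e A _
  have hx : ∀ k, inner 𝕜 (e k) (e n) = if k ∈ ({n} : Finset ℕ) then (1 : 𝕜) else 0 := fun k => by
    simpa using orthonormal_iff_ite.1 e.orthonormal k n
  have hyE : FiniteEnergy e y := summable_of_ne_finset_zero (s := A) fun k hk => by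
    rw [hy, if_neg hk]
    simp
  have hxE : FiniteEnergy e (e n) := summable_of_ne_finset_zero (s := {n}) fun k hk => by
    rw [hx, if_neg hk]
    simp
  have hxe : energy e n (e n) = 1 := by
    rw [energy, tsum_eq_single n fun k hk => by rw [hx, if_neg (by simpa using hk)]; simp, hx]
    simp [weight]
  have hye : energy e n y ≤ 2 * P := by
    rw [energy, tsum_eq_sum (s := A) fun k hk => by rw [hy, if_neg hk]; simp, hP', Finset.mul_sum]
    refine Finset.sum_le_sum fun k hk => ?_
    have h0 : (n : ℝ) - k ≠ 0 := sub_ne_zero.2 (by exact_mod_cast (hA k hk).symm)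
    rw [hy, if_pos hk, norm_div, RCLike.norm_ofReal, abs_of_nonneg (sq_nonneg _), div_pow]
    calc _ ≤ 2 * ((n : ℝ) - k) ^ 2 * (‖entry e R k n‖ ^ 2 / (((n : ℝ) - k) ^ 2) ^ 2) := by
          gcongr
          exact weight_le_two_mul_sq (hA k hk)
      _ = _ := by field_simp
  have hyR : inner 𝕜 y (R (e n)) = (P : 𝕜) := by
    rw [hP', sum_inner, RCLike.ofReal_sum]
    refine Finset.sum_congr rfl fun k hk => ?_
    have hk : inner 𝕜 (e k) (R (e n)) = entry e R k n := rfl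
    rw [inner_smul_left, map_div₀, RCLike.conj_ofReal, hk, div_mul_eq_mul_div, RCLike.conj_mul,
      RCLike.ofReal_div, RCLike.ofReal_pow ‖_‖]
  have h := hN n hn.le (e n) y hxE hyE
  rw [hxe, hyR, RCLike.norm_ofReal, abs_of_nonneg hP0, Real.sqrt_one, mul_one] at h
  have h2 : P ≤ δ / 2 * √(2 * P) := h.trans (by gcongr)
  have h3 : P * P ≤ 2 * (δ / 2) ^ 2 * P := by
    calc P * P ≤ (δ / 2 * √(2 * P)) * (δ / 2 * √(2 * P)) := by gcongr
      _ = (δ / 2) ^ 2 * (√(2 * P) * √(2 * P)) := by ring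
      _ = _ := by rw [Real.mul_self_sqrt (by positivity)]; ring
  rcases hP0.eq_or_lt with h0 | h0
  · rw [← h0]
    positivity
  · exact le_of_mul_le_mul_right h3 h0

theorem half_abs_le_abs_sub {n k : ℕ} {l : ℝ} (hl : |l - n| ≤ 1 / 2) (hk : k ≠ n) :
    1 / 2 * |(n : ℝ) - k| ≤ |(k : ℝ) - l| := by
  have h1 : (1 : ℤ) ≤ |(n : ℤ) - k| := Int.one_le_abs (by omega)
  have h2 : (1 : ℝ) ≤ |(n : ℝ) - k| := by exact_mod_cast h1
  have h3 := abs_sub_abs_le_abs_sub ((n : ℝ) - k) (-(l - n))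
  rw [abs_neg, show (n : ℝ) - k - -(l - n) = l - k by ring, abs_sub_comm l k] at h3
  linarith

/-- An eigenvector with eigenvalue near `n` has a large component along `e n`. -/
theorem SmallForm.half_le_sq_norm_inner {n : ℕ} (h : SmallForm e R n) (hD : IsNumberOperator e D)
    {l : ℝ} (hl : |l - n| ≤ 1 / 2) {x : (perturb D R).domain}
    (hx : perturb D R x = (l : 𝕜) • (x : H)) (hx1 : ‖(x : H)‖ = 1) :
    1 / 2 ≤ ‖inner 𝕜 (e n) (x : H)‖ ^ 2 := by
  have hE := FiniteEnergy.of_domain hD x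
  -- The sign of `k - n`: it makes `σ k (k - l) ≥ (1/4) weight n k` for every `k ≠ n`, with equality
  -- possible when `|k - n| = 1`. As `σ = 1` beyond `n`, the vector `y = σ(D) x` differs from `x` in
  -- finitely many coordinates.
  let σ : ℕ → ℝ := fun k => if k < n then -1 else if k = n then 0 else 1
  let y : H := (x : H) - ∑ k ∈ Finset.range (n + 1),
    (((1 - σ k : ℝ) : 𝕜) * inner 𝕜 (e k) (x : H)) • e k
  have hy : ∀ k, inner 𝕜 (e k) y = (σ k : 𝕜) * inner 𝕜 (e k) (x : H) := by
    intro k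
    rw [inner_sub_right, inner_sum_smul]
    split_ifs with hk
    · push_cast
      ring
    · have : σ k = 1 := by
        rw [Finset.mem_range] at hk
        simp only [σ, if_neg (show ¬ k < n by omega), if_neg (show ¬ k = n by omega)]
      rw [this]
      simp
  have hyx : ∀ k, ‖inner 𝕜 (e k) y‖ ≤ ‖inner 𝕜 (e k) (x : H)‖ := by
    intro k
    rw [hy, norm_mul, RCLike.norm_ofReal]
    refine mul_le_of_le_one_left (norm_nonneg _) ?_
    simp only [σ]
    split_ifs <;> simp
  have hs := hasSum_form hD x l hy
  rw [hx, sub_self, inner_zero_right, map_zero, zero_sub] at hs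
  have hbound := abs_le.1 (h.abs_re_inner_le hE hyx)
  have hsub : HasSum (fun k => 1 / 4 * (weight n k * ‖inner 𝕜 (e k) (x : H)‖ ^ 2) -
      if k = n then 1 / 4 * ‖inner 𝕜 (e n) (x : H)‖ ^ 2 else 0)
      (1 / 4 * energy e n x - 1 / 4 * ‖inner 𝕜 (e n) (x : H)‖ ^ 2) :=
    ((hE.summable n).hasSum.mul_left (1 / 4)).sub (hasSum_ite_eq n _)
  have hle := hasSum_le (fun k => ?_) hsub hs
  -- With `E` the energy of `x`, `E/4 - |x_n|²/4 ≤ E/8` and `E ≥ 1` give `|x_n|² ≥ 1/2`.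
  · have h1 := hE.sq_norm_le_energy n
    rw [hx1] at h1
    linarith [hbound.1]
  · rcases eq_or_ne k n with rfl | hk
    · simp [σ, weight]
    · rw [if_neg hk, sub_zero, ← mul_assoc]
      refine mul_le_mul_of_nonneg_right ?_ (sq_nonneg _)
      have hl' := abs_le.1 hl
      rcases lt_or_gt_of_ne hk with hk' | hk'
      · have : (k : ℝ) + 1 ≤ n := by exact_mod_cast hk'
        simp only [σ, if_pos hk', weight]
        rw [abs_of_nonpos (by linarith)]
        linarith
      · have : (n : ℝ) + 1 ≤ k := by exact_mod_cast hk'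
        simp only [σ, if_neg hk'.not_gt, if_neg hk, weight]
        rw [abs_of_nonneg (by linarith)]
        linarith

theorem hasSum_subtype_ne {f : ℕ → 𝕜} {a : 𝕜} (hf : HasSum f a) (n : ℕ) :
    HasSum (fun k : {k : ℕ // k ≠ n} => f k) (a - f n) := by
  have h := (Subtype.val_injective (p := fun k : ℕ => k ≠ n)).hasSum_iff
    (f := fun k => if k = n then 0 else f k) (a := a - f n) fun k hk => by
      rw [Subtype.range_coe_subtype] at hk
      exact if_pos (not_not.1 hk)
  refine (h.2 (hasSum_ite_sub_hasSum hf n)).congr_fun fun k => ?_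
  exact (if_neg k.2).symm

/-- The first-order perturbation estimate for the eigenvalue near `n`. -/
theorem SmallForm.norm_eigenvalue_sub_le [CompleteSpace H] {n : ℕ} (h : SmallForm e R n)
    (hD : IsNumberOperator e D) (hR : IsSelfAdjoint R)
    {l : ℝ} (hl : |l - n| ≤ 1 / 2) {x : H}
    (hx : IsEigenpair (perturb D R) l x) (hx1 : ‖x‖ = 1) :
    ‖(l : 𝕜) - ((n : 𝕜) + entry e R n n)‖ ≤ 4 * ‖R‖ * remainder e R n := by
  obtain ⟨hxd, hTx⟩ := hx
  have hhalf := h.half_le_sq_norm_inner hD hl hTx hx1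
  change 1 / 2 ≤ ‖inner 𝕜 (e n) x‖ ^ 2 at hhalf
  have hcoord : ∀ k : ℕ, ((l : 𝕜) - (k : 𝕜)) * inner 𝕜 (e k) x = inner 𝕜 (e k) (R x) := fun k => by
    have := inner_perturb hD ⟨x, hxd⟩ k
    rw [hTx, inner_smul_right] at this
    linear_combination this
  have hRsum : HasSum (fun k => inner 𝕜 (R (e n)) (e k) * inner 𝕜 (e k) x)
      (inner 𝕜 (e n) (R x)) := by
    have h1 : inner 𝕜 (R (e n)) x = inner 𝕜 (e n) (R x) := hR.isSymmetric (e n) x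
    rw [← h1]
    exact e.hasSum_inner_mul_inner _ _
  have hRn : inner 𝕜 (R (e n)) (e n) = entry e R n n := hR.isSymmetric (e n) (e n)
  have hoff : HasSum (fun k : {k : ℕ // k ≠ n} => inner 𝕜 (R (e n)) (e k) * inner 𝕜 (e k) x)
      (((l : 𝕜) - ((n : 𝕜) + entry e R n n)) * inner 𝕜 (e n) x) := by
    have h1 := hasSum_subtype_ne hRsum n
    rwa [← hcoord n, hRn, ← sub_mul, sub_sub] at h1
  -- Split for Cauchy–Schwarz: `a` has `ℓ²` norm `s_n`, and `b k ≤ 2 |(R x)_k|` bounds the norm of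
  -- `b` by `2‖R‖`.
  let a : {k : ℕ // k ≠ n} → ℝ := fun k => ‖entry e R k n‖ / |(n : ℝ) - (k : ℕ)|
  let b : {k : ℕ // k ≠ n} → ℝ := fun k => |(n : ℝ) - (k : ℕ)| * ‖inner 𝕜 (e k) x‖
  have ha0 : ∀ k, 0 ≤ a k := fun k => by positivity
  have hb0 : ∀ k, 0 ≤ b k := fun k => by positivity
  have ha : ∀ k, a k ^ 2 = ‖entry e R k n‖ ^ 2 / ((n : ℝ) - (k : ℕ)) ^ 2 := fun k => by
    rw [div_pow, sq_abs]
  have hasum : Summable fun k => a k ^ 2 := by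
    simp only [ha]
    exact summable_remainder e R n
  have hrem : √(∑' k, a k ^ 2) = remainder e R n := by
    simp only [ha]
    rfl
  have hb : ∀ k, b k ^ 2 ≤ 4 * ‖inner 𝕜 (e k) (R x)‖ ^ 2 := fun k => by
    have h1 : b k ≤ 2 * ‖inner 𝕜 (e k) (R x)‖ := by
      rw [← hcoord k, norm_mul, ← mul_assoc]
      refine mul_le_mul_of_nonneg_right ?_ (norm_nonneg _)
      have h2 := half_abs_le_abs_sub hl k.2
      have h3 : ‖(l : 𝕜) - ((k : ℕ) : 𝕜)‖ = |((k : ℕ) : ℝ) - l| := by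
        rw [norm_sub_rev, ← RCLike.norm_ofReal (K := 𝕜)]
        push_cast
        rfl
      rw [h3]
      linarith
    calc b k ^ 2 ≤ (2 * ‖inner 𝕜 (e k) (R x)‖) ^ 2 := by
          have := hb0 k
          gcongr
      _ = _ := by ring
  have hRx := (hasSum_sq_norm_inner e (R x)).mul_left 4
  have hRx' := hRx.summable.comp_injective (Subtype.val_injective (p := fun k : ℕ => k ≠ n))
  have hbsum : Summable fun k => b k ^ 2 :=
    Summable.of_nonneg_of_le (fun k => sq_nonneg _) hb hRx'
  have hbtsum : √(∑' k, b k ^ 2) ≤ 2 * ‖R‖ := by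
    rw [Real.sqrt_le_left (by positivity)]
    calc ∑' k, b k ^ 2 ≤ ∑' k : {k : ℕ // k ≠ n}, 4 * ‖inner 𝕜 (e k) (R x)‖ ^ 2 :=
          hbsum.tsum_le_tsum hb hRx'
      _ ≤ ∑' k : ℕ, 4 * ‖inner 𝕜 (e k) (R x)‖ ^ 2 :=
          hRx.summable.tsum_subtype_le _ {k : ℕ | k ≠ n} fun k => by positivity
      _ = 4 * ‖R x‖ ^ 2 := hRx.tsum_eq
      _ ≤ 4 * (‖R‖ * 1) ^ 2 := by
          gcongr
          rw [← hx1]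
          exact R.le_opNorm x
      _ = _ := by ring
  obtain ⟨habs, hcs⟩ := Real.summable_and_inner_le_Lp_mul_Lq_tsum_of_nonneg
    Real.HolderConjugate.two_two ha0 hb0 (by simpa using hasum) (by simpa using hbsum)
  simp only [Real.rpow_two, ← Real.sqrt_eq_rpow] at hcs
  rw [hrem] at hcs
  have hterm : ∀ k : {k : ℕ // k ≠ n},
      ‖inner 𝕜 (R (e n)) (e k) * inner 𝕜 (e k) x‖ ≤ a k * b k := fun k => by
    have h0 : |(n : ℝ) - (k : ℕ)| ≠ 0 :=
      abs_ne_zero.2 (sub_ne_zero.2 (by exact_mod_cast k.2.symm))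
    have h1 : a k * b k = ‖entry e R k n‖ * ‖inner 𝕜 (e k) x‖ := by
      simp only [a, b]
      field_simp
    rw [h1, norm_mul, norm_inner_symm, entry]
  have hfinal : ‖((l : 𝕜) - ((n : 𝕜) + entry e R n n)) * inner 𝕜 (e n) x‖ ≤
      remainder e R n * (2 * ‖R‖) := by
    rw [← hoff.tsum_eq]
    refine (tsum_of_norm_bounded habs.hasSum hterm).trans (hcs.trans ?_)
    gcongr
    exact Real.sqrt_nonneg _
  rw [norm_mul] at hfinal
  -- The weaker bound `1/2` in place of `1/√2` suffices; dividing by it turns `2‖R‖` into `4‖R‖`.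
  have h12 : 1 / 2 ≤ ‖inner 𝕜 (e n) x‖ := by
    by_contra! hlt
    have := norm_nonneg (inner 𝕜 (e n) x)
    nlinarith
  have := mul_le_mul_of_nonneg_left h12 (norm_nonneg ((l : 𝕜) - ((n : 𝕜) + entry e R n n)))
  linarith

theorem IsEigenvalueEnumeration.mem_range_of_ne_bot {T : H →ₗ.[𝕜] H} {lam : ℕ → ℝ}
    (h : IsEigenvalueEnumeration T lam) {μ : 𝕜} (hμ : eigenspace T μ ≠ ⊥) :
    ∃ n, (lam n : 𝕜) = μ := by
  obtain ⟨hfin, hcard⟩ := h.2 μ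
  by_contra! hne
  rw [Set.eq_empty_of_forall_notMem (s := {n : ℕ | (lam n : 𝕜) = μ}) fun n hn => hne n hn,
    Set.encard_empty] at hcard
  exact hμ (Submodule.finrank_eq_zero.1 (by exact_mod_cast hcard.symm))

/-- All but finitely many eigenvalues exceed `re μ + 1`, hence are at distance at least `1` from
`μ`; the finitely many others, `μ` excluded, form a closed set. -/
theorem hasDiscreteSpectrum_of_enumeration [CompleteSpace H] {T : H →ₗ.[𝕜] H} {c : 𝕜}
    {S : H →L[𝕜] H} (hS : IsCompactResolvent T c S) {lam : ℕ → ℝ}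
    (hlam : IsEigenvalueEnumeration T lam) (htop : Tendsto lam atTop atTop) :
    HasDiscreteSpectrum T := by
  intro μ hμ
  refine ⟨?_, hS.eigenspace_ne_bot hμ, hS.finiteDimensional_eigenspace μ⟩
  obtain ⟨N, hN⟩ := eventually_atTop.1 (htop.eventually_ge_atTop (RCLike.re μ + 1))
  have hF : (((fun n => (lam n : 𝕜)) '' Set.Iio N) \ {μ}).Finite :=
    ((Set.finite_Iio N).image _).sdiff
  obtain ⟨ε, hε, hball⟩ := Metric.isOpen_iff.1 hF.isClosed.isOpen_compl μ (by simp)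
  refine ⟨min ε 1, by positivity, fun ν hν hne => ?_⟩
  obtain ⟨n, rfl⟩ := hlam.mem_range_of_ne_bot (hS.eigenspace_ne_bot hν)
  rcases lt_or_ge n N with hn | hn
  · refine (min_le_left _ _).trans ?_
    by_contra! hlt
    exact hball hlt ⟨⟨n, hn, rfl⟩, hne⟩
  · refine (min_le_right _ _).trans ?_
    rw [dist_eq_norm]
    refine le_trans ?_ (RCLike.re_le_norm _)
    rw [map_sub, RCLike.ofReal_re]
    linarith [hN n hn]

end

end PerturbedOscillator

open PerturbedOscillator in
theorem theorem1 {𝕜 : Type*} [RCLike 𝕜] {H : Type*} [NormedAddCommGroup H]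
    [InnerProductSpace 𝕜 H] [CompleteSpace H]
    (D : H →ₗ.[𝕜] H) (hD : IsSelfAdjoint D)
    (e : HilbertBasis ℕ 𝕜 H)
    (he : ∀ n : ℕ, ∃ hn : e n ∈ D.domain, D ⟨e n, hn⟩ = (n : 𝕜) • e n)
    (R : H →L[𝕜] H) (hR : IsSelfAdjoint R)
    (hlim : ∀ p : ℤ,
      Tendsto (fun n : ℕ => PerturbedOscillator.entry e R n ((n : ℤ) + p).toNat) atTop (𝓝 0)) :
    PerturbedOscillator.HasDiscreteSpectrum (PerturbedOscillator.perturb D R) ∧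
    (∃ lam : ℕ → ℝ,
      PerturbedOscillator.IsEigenvalueEnumeration (PerturbedOscillator.perturb D R) lam) ∧
    (∀ lam : ℕ → ℝ,
      PerturbedOscillator.IsEigenvalueEnumeration (PerturbedOscillator.perturb D R) lam →
      (∀ᶠ n in atTop, Module.finrank 𝕜
        (PerturbedOscillator.eigenspace (PerturbedOscillator.perturb D R) (lam n : 𝕜)) = 1) ∧
      (fun n : ℕ => (lam n : 𝕜) - ((n : 𝕜) + PerturbedOscillator.entry e R n n))
        =O[atTop] PerturbedOscillator.remainder e R) ∧
    Tendsto (PerturbedOscillator.remainder e R) atTop (𝓝 0) := by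
  have hN := isNumberOperator_of_isSelfAdjoint hD he
  have hsymm := perturb_symmetric hN hR
  obtain ⟨c, S, hS⟩ := exists_isCompactResolvent hN hR
  have hsmall : ∀ᶠ n in atTop, SmallForm e R n :=
    eventually_norm_inner_le hlim (by norm_num)
  obtain ⟨N, hN0⟩ := eventually_atTop.1 hsmall
  have hloc : ∀ lam : ℕ → ℝ, IsEigenvalueEnumeration (perturb D R) lam →
      ∃ f : HilbertBasis ℕ 𝕜 H, (∀ n, IsEigenpair (perturb D R) (lam n) (f n)) ∧
        ∀ n ≥ N, lam n < n + 1 / 2 ∧ n + 1 / 2 < lam (n + 1) := by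
    intro lam hlam
    obtain ⟨f, hf⟩ := hlam.exists_hilbertBasis hS hsymm
    exact ⟨f, hf, fun n hn => (hN0 n hn).eigenvalue_lt_and_lt hN hR hlam.1 f hf⟩
  obtain ⟨lam₀, hlam₀⟩ := exists_isEigenvalueEnumeration e hS hsymm (hasFiniteCounting hN hsmall)
  refine ⟨?_, ⟨lam₀, hlam₀⟩, fun lam hlam => ?_, tendsto_remainder hlim⟩
  · obtain ⟨f, -, hb⟩ := hloc lam₀ hlam₀
    refine hasDiscreteSpectrum_of_enumeration hS hlam₀ ?_
    rw [← tendsto_add_atTop_iff_nat 1]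
    refine tendsto_atTop_mono' _ ?_ tendsto_natCast_atTop_atTop
    filter_upwards [eventually_ge_atTop N] with n hn
    linarith [(hb n hn).2]
  · obtain ⟨f, hf, hb⟩ := hloc lam hlam
    constructor
    -- Starting at `N + 1` makes both separators `n - 1/2` and `n + 1/2` available, isolating `lam
    -- n` strictly from its neighbours.
    · filter_upwards [eventually_ge_atTop (N + 1)] with n hn
      obtain ⟨m, rfl⟩ : ∃ m, n = m + 1 := ⟨n - 1, by omega⟩
      have h1 := hb m (by omega)
      have h2 := hb (m + 1) (by omega)
      have hset : {k : ℕ | (lam k : 𝕜) = (lam (m + 1) : 𝕜)} = {m + 1} := by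
        ext k
        simp only [RCLike.ofReal_inj, Set.mem_ofPred_eq, Set.mem_singleton_iff]
        refine ⟨fun hk => ?_, fun hk => by rw [hk]⟩
        rcases lt_trichotomy k (m + 1) with h | h | h
        · linarith [hlam.1 (show k ≤ m by omega)]
        · exact h
        · linarith [hlam.1 (show m + 1 + 1 ≤ k by omega)]
      have hcard := (hlam.2 (lam (m + 1) : 𝕜)).2
      rw [hset, Set.encard_singleton] at hcard
      exact_mod_cast hcard.symm
    · refine IsBigO.of_bound (4 * ‖R‖) ?_
      filter_upwards [eventually_ge_atTop (N + 1)] with n hn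
      rw [Real.norm_of_nonneg (show 0 ≤ remainder e R n from Real.sqrt_nonneg _)]
      refine (hN0 n (by omega)).norm_eigenvalue_sub_le hN hR ?_ (hf n) (f.orthonormal.1 n)
      obtain ⟨m, rfl⟩ : ∃ m, n = m + 1 := ⟨n - 1, by omega⟩
      have h1 := (hb m (by omega)).2
      have h2 := (hb (m + 1) (by omega)).1
      rw [abs_le]
      push_cast at h2 ⊢
      constructor <;> linarith
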